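/- Let $(\Omega,\mathcal A,\mathbb P)$ be a probability space, $T\ge 0$, and let $(A_\ell)_{\ell\ge0}$ be nonnegative reals with $\sum_\ell(2\ell+1)A_\ell<\infty$. Let $P_\ell(\mu)=\frac{1}{2^\ell\ell!}\frac{d^\ell}{d\mu^\ell}(\mu^2-1)^\ell$ and $P_{\ell,m}(\mu)=(-1)^m(1-\mu^2)^{m/2}P_\ell^{(m)}(\mu)$. For $0\le m\le\ell$ put $L_{\ell,m}(\vartheta)=\sqrt{\frac{2\ell+1}{4\pi}\frac{(\ell-m)!}{(\ell+m)!}}\,P_{\ell,m}(\cos\vartheta)$ and $Y_{\ell,m}(y)=L_{\ell,m}(\vartheta)e^{\mathrm i m\varphi}$ at the point $y=(\sin\vartheta\cos\varphi,\sin\vartheta\sin\varphi,\cos\vartheta)\in\mathbb S^2$, where $\vartheta\in[0,\pi]$ and $\varphi\in[0,2\pi)$; for $-\ell\le m<0$ put $Y_{\ell,m}=(-1)^m\overline{Y_{\ell,-m}}$. Let $\beta_1^{\ell,m}$ ($0\le m\le\ell$) and $\beta_2^{\ell,m}$ ($1\le m\le\ell$), $\ell\ge 0$, be independent real Brownian motions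 on $[0,T]$, and let $$W(t)=\sum_{\ell\ge0}\sum_{m=-\ell}^{\ell}a^{\ell,m}(t)Y_{\ell,m}=\sum_{\ell\ge0}\Big(\sqrt{A_\ell}\,\beta_1^{\ell,0}(t)Y_{\ell,0}+\sqrt{2A_\ell}\sum_{m=1}^{\ell}\big(\beta_1^{\ell,m}(t)\operatorname{Re}Y_{\ell,m}+\beta_2^{\ell,m}(t)\operatorname{Im}Y_{\ell,m}\big)\Big)$$ be the corresponding isotropic $Q$-Wiener process with values in $L^2(\mathbb S^2)$. That is, $a^{\ell,0}=\sqrt{A_\ell}\,\beta^{\ell,0}_1$, and for $m\ge1$, $a^{\ell,m}=\sqrt{A_\ell/2}\,(\beta^{\ell,m}_1-\mathrm i\beta^{\ell,m}_2)$ and $a^{\ell,-m}=(-1)^m\overline{a^{\ell,m}}$. Write $\lambda_\ell=\ell(\ell+1)$ and fix $t\in[0,T]$. For $\ell\ne0$ let $$\hat W^{\ell,m}(t)=\int_0^tR^\ell(t-s)\,da^{\ell,m}(s),\qquad R^\ell(t)=\begin{pmatrix}\lambda_\ell^{-1/2}\sin(\lambda_\ell^{1/2}t)\\ \cos(\lambda_\ell^{1/2}t)\end{pmatrix}$$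 (Wiener integrals), and let $\hat W^{0,0}(t)=\big(\int_0^ta^{0,0}(s)\,ds,\ a^{0,0}(t)\big)^T$. The stochastic convolution is the $\mathbb R^2$-valued random field $\hat W(t,y)=\sum_{\ell\ge0}\sum_{m=-\ell}^{\ell}\hat W^{\ell,m}(t)Y_{\ell,m}(y)$ on $\mathbb S^2$, that is, a jointly measurable field to which the series converges in $L^2(\Omega)$ at every point $y$ and in $L^2(\Omega;L^2(\mathbb S^2))$. Let $C_0(t)=\begin{pmatrix}t^3/3&t^2/2\\t^2/2&t\end{pmatrix}$ and, for $\ell\neq0$, $$C_\ell(t)=\begin{pmatrix}\dfrac{2\lambda_\ell^{1/2}t-\sin(2\lambda_\ell^{1/2}t)}{4\lambda_\ell^{3/2}}&\dfrac{\sin^2(\lambda_\ell^{1/2}t)}{2\lambda_\ell}\\[2ex]\dfrac{\sin^2(\lambda_\ell^{1/2}t)}{2\lambda_\ell}&\dfrac{2\lambda_\ell^{1/2}t+\sin(2\lambda_\ell^{1/2}t)}{4\lambda_\ell^{1/2}}\end{pmatrix}.$$ **Proposition 3.1.** 1. The coefficient pairs $\hat W^{\ell,m}(t)$ are well defined, square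 integrable and centered, and $\mathbb E\big[\hat W^{\ell,m}(t)\,\hat W^{\ell,m}(t)^{*}\big]=A_\ell\,C_\ell(t)$ for all $\ell\ge0$, $-\ell\le m\le\ell$. 2. Each $C_\ell(t)$ has a unique Cholesky factor (lower triangular, nonnegative diagonal, $D_\ell(t)D_\ell(t)^T=C_\ell(t)$). 3. The field $\hat W(t)$ exists. It is Gaussian with mean zero: all vectors $(\hat W(t,y_1),\dots,\hat W(t,y_k))$ are centered Gaussian. 4. Let $D_\ell(t)$ be the Cholesky factor of $C_\ell(t)$ or, more generally, any real $2\times2$ matrix with $D_\ell(t)D_\ell(t)^T=C_\ell(t)$. Let $X_i^{\ell,m}=(X_{i,1}^{\ell,m},X_{i,2}^{\ell,m})^T$ have independent $\mathcal N(0,1)$ components, independent over all indices $(i,\ell,m)$ with $i=1$, $0\le m\le\ell$ or $i=2$, $1\le m\le\ell$. Put $\hat\beta_i^{\ell,m}(t)=D_\ell(t)X_i^{\ell,m}$. Then, in the same sense of convergence, the series $$\sum_{\ell\ge0}\Big(\sqrt{A_\ell}\,\hat\beta_1^{\ell,0}(t)Y_{\ell,0}(y)+\sqrt{2A_\ell}\sum_{m=1}^{\ell}\big(\hat\beta_1^{\ell,m}(t)\operatorname{Re}Y_{\ell,m}(y)+\hat\beta_2^{\ell,m}(t)\operatorname{Im}Y_{\ell,m}(y)\big)\Big)$$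 $$=\sum_{\ell\ge0}\Big(\sqrt{A_\ell}\,\hat\beta_1^{\ell,0}(t)L_{\ell,0}(\vartheta)+\sqrt{2A_\ell}\sum_{m=1}^{\ell}L_{\ell,m}(\vartheta)\big(\hat\beta_1^{\ell,m}(t)\cos(m\varphi)+\hat\beta_2^{\ell,m}(t)\sin(m\varphi)\big)\Big)$$ converges (the two series agree term by term), and its sum has the same distribution, as an $\mathbb R^2$-valued field on $\mathbb S^2$, as $\hat W(t,\cdot)$. Moreover the whole family $(\hat W^{\ell,m}(t))_{\ell,m}$ has the same joint distribution as the family of coefficients of this series with respect to the $Y_{\ell,m}$, namely $\sqrt{A_\ell}\,\hat\beta_1^{\ell,0}(t)$ for $m=0$, $\sqrt{A_\ell/2}\,\big(\hat\beta_1^{\ell,m}(t)-\mathrm i\hat\beta_2^{\ell,m}(t)\big)$ for $m>0$, and $(-1)^m\sqrt{A_\ell/2}\,\big(\hat\beta_1^{\ell,-m}(t)+\mathrm i\hat\beta_2^{\ell,-m}(t)\big)$ for $m<0$. -/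

import Mathlib

open MeasureTheory ProbabilityTheory Filter Topology
open scoped NNReal ENNReal

noncomputable section

/-! ### The sphere and the spherical harmonics -/

/-- The unit sphere of Euclidean 3-space. -/
abbrev S2 : Type := Metric.sphere (0 : EuclideanSpace ℝ (Fin 3)) 1

/-- The surface (Lebesgue) measure on the unit sphere, of total mass `4π`. -/
def surfaceMeasure : Measure S2 := (volume : Measure (EuclideanSpace ℝ (Fin 3))).toSphere

/-- The point with polar angle `θ` and azimuth `φ`. -/
def sphPoint (θ φ : ℝ) : S2 :=
  ⟨!₂[Real.sin θ * Real.cos φ, Real.sin θ * Real.sin φ, Real.cos θ], by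
    rw [mem_sphere_zero_iff_norm, EuclideanSpace.norm_eq, Real.sqrt_eq_one, Fin.sum_univ_three]
    simp only [Real.norm_eq_abs, sq_abs]
    simp
    nlinarith [Real.sin_sq_add_cos_sq θ, Real.sin_sq_add_cos_sq φ]⟩

/-- Legendre polynomials, by Rodrigues' formula. -/
def legendreP (l : ℕ) : Polynomial ℝ :=
  Polynomial.C ((2 : ℝ) ^ l * (l.factorial : ℝ))⁻¹ *
    Polynomial.derivative^[l] ((Polynomial.X ^ 2 - 1) ^ l)

/-- Associated Legendre functions `P_{l,m}(μ) = (-1)^m (1 - μ²)^{m/2} P_l^{(m)}(μ)` on `[-1,1]`. -/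
def assocLegendre (l m : ℕ) (μ : ℝ) : ℝ :=
  (-1) ^ m * Real.sqrt (1 - μ ^ 2) ^ m * (Polynomial.derivative^[m] (legendreP l)).eval μ

/-- The functions `L_{l,m}(θ)`, `0 ≤ m ≤ l`: normalized associated Legendre functions of `cos θ`. -/
def normLegendre (l m : ℕ) (θ : ℝ) : ℝ :=
  Real.sqrt ((2 * l + 1) / (4 * Real.pi) * ((l - m).factorial / (l + m).factorial)) *
    assocLegendre l m (Real.cos θ)

/-- Surface spherical harmonics `Y_{l,m}(θ, φ)`, `-l ≤ m ≤ l`, in angular coordinates; for `m < 0`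
they are `(-1)^m` times the conjugate of `Y_{l,-m}`. -/
def sphHarmAngle (l : ℕ) (m : ℤ) (θ φ : ℝ) : ℂ :=
  if 0 ≤ m then
    (normLegendre l m.natAbs θ : ℂ) * Complex.exp (Complex.I * (m.natAbs : ℂ) * (φ : ℂ))
  else
    (-1) ^ m.natAbs * (starRingEnd ℂ)
      ((normLegendre l m.natAbs θ : ℂ) * Complex.exp (Complex.I * (m.natAbs : ℂ) * (φ : ℂ)))

/-- Spherical harmonics as functions on the sphere. The value depends on the azimuth only modulo
`2π`, and at the poles, where `Complex.arg` is a junk value, it does not depend on it. -/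
def sphHarm (l : ℕ) (m : ℤ) (y : S2) : ℂ :=
  sphHarmAngle l m (Real.arccos (y.1 2)) (Complex.arg ⟨y.1 0, y.1 1⟩)

/-! ### Expansions in spherical harmonics

A family of real weights `b i l m` is indexed by `i : Fin 2` (`0` for the cosine / real part, `1` for
the sine / imaginary part), `l`, and `0 ≤ m ≤ l`, where `i = 1` only occurs for `m ≥ 1`. -/

/-- The indices `(i, l, m)` of the real modes. -/
abbrev ModeIndex : Type :=
  {p : Fin 2 × ℕ × ℕ // p.2.2 ≤ p.2.1 ∧ (p.1 = 1 → 1 ≤ p.2.2)}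

/-- The truncated complex expansion `∑_{l ≤ N} ∑_{m=-l}^{l} c^{l,m} Y_{l,m}(y)`. -/
def complexExpansion (c : ℕ → ℤ → ℂ) (N : ℕ) (y : S2) : ℂ :=
  ∑ l ∈ Finset.range (N + 1), ∑ m ∈ Finset.Icc (-(l : ℤ)) (l : ℤ), c l m * sphHarm l m y

/-- The truncated real expansion in `Re Y_{l,m}` and `Im Y_{l,m}`. -/
def realExpansion (A : ℕ → ℝ) (b : Fin 2 → ℕ → ℕ → ℝ) (N : ℕ) (y : S2) : ℝ :=
  ∑ l ∈ Finset.range (N + 1),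
    (Real.sqrt (A l) * b 0 l 0 * (sphHarm l 0 y).re +
      Real.sqrt (2 * A l) * ∑ m ∈ Finset.Icc 1 l,
        (b 0 l m * (sphHarm l m y).re + b 1 l m * (sphHarm l m y).im))

/-- The truncated real expansion in angular coordinates. -/
def angularExpansion (A : ℕ → ℝ) (b : Fin 2 → ℕ → ℕ → ℝ) (N : ℕ) (θ φ : ℝ) : ℝ :=
  ∑ l ∈ Finset.range (N + 1),
    (Real.sqrt (A l) * b 0 l 0 * normLegendre l 0 θ +
      Real.sqrt (2 * A l) * ∑ m ∈ Finset.Icc 1 l,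
        normLegendre l m θ * (b 0 l m * Real.cos (m * φ) + b 1 l m * Real.sin (m * φ)))

/-- The coefficients with respect to the complex basis `Y_{l,m}`, `-l ≤ m ≤ l`, of the real
expansion with spectrum `A` and weights `b`; see `complexExpansion_fieldCoeff`. -/
def fieldCoeff (A : ℕ → ℝ) (b : Fin 2 → ℕ → ℕ → ℝ) (l : ℕ) (m : ℤ) : ℂ :=
  if m = 0 then (Real.sqrt (A l) : ℂ) * (b 0 l 0 : ℂ)
  else if 0 < m then
    (Real.sqrt (A l / 2) : ℂ) * ((b 0 l m.natAbs : ℂ) - Complex.I * (b 1 l m.natAbs : ℂ))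
  else
    (-1) ^ m.natAbs * (Real.sqrt (A l / 2) : ℂ) *
      ((b 0 l m.natAbs : ℂ) + Complex.I * (b 1 l m.natAbs : ℂ))

/-! ### The driving noise -/

/-- `B` is a (standard, real) Brownian motion on the time interval `[0,T]`: its finite-dimensional
laws at times in `[0,T]` are those of Brownian motion, and its paths are a.s. continuous on `[0,T]`.
Values at times beyond `T` play no role. -/
structure IsBrownianOn {Ω : Type*} [MeasurableSpace Ω] (T : ℝ≥0) (B : ℝ≥0 → Ω → ℝ)
    (P : Measure Ω) : Prop where
  measurable : ∀ s ≤ T, Measurable (B s)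
  hasLaw : ∀ I : Finset ℝ≥0, (∀ s ∈ I, s ≤ T) →
    HasLaw (fun ω ↦ I.restrict (B · ω)) (BrownianReal.projectiveFamily I) P
  cont : ∀ᵐ ω ∂P, ContinuousOn (B · ω) (Set.Iic T)

/-- The data of an isotropic `Q`-Wiener process on `[0,T]` with values in `L²(S²)` and angular power
spectrum `A` (`Q Y_{l,m} = A_l Y_{l,m}`, `Q` of trace class), that is
`W(t) = ∑_l (√A_l β₁^{l,0}(t) Y_{l,0} + √(2A_l) ∑_{m=1}^l (β₁^{l,m}(t) Re Y_{l,m} + β₂^{l,m}(t) Im Y_{l,m}))`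
with independent Brownian motions `β₁^{l,m} = β 0 l m` (`0 ≤ m ≤ l`) and
`β₂^{l,m} = β 1 l m` (`1 ≤ m ≤ l`). -/
structure IsIsotropicWiener {Ω : Type*} [MeasurableSpace Ω] (T : ℝ≥0) (A : ℕ → ℝ)
    (β : Fin 2 → ℕ → ℕ → ℝ≥0 → Ω → ℝ) (P : Measure Ω) : Prop where
  spectrum_nonneg : ∀ l, 0 ≤ A l
  trace_class : Summable fun l : ℕ ↦ (2 * (l : ℝ) + 1) * A l
  brownian : ∀ p : ModeIndex, IsBrownianOn T (β p.1.1 p.1.2.1 p.1.2.2) P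
  indep : iIndepFun
    (fun (p : ModeIndex) (ω : Ω) (s : Set.Iic T) ↦ β p.1.1 p.1.2.1 p.1.2.2 s.1 ω) P

/-- The coefficients `a^{l,m}(s)` of `W(s) = ∑_l ∑_m a^{l,m}(s) Y_{l,m}`. -/
def noiseCoeff {Ω : Type*} (A : ℕ → ℝ) (β : Fin 2 → ℕ → ℕ → ℝ≥0 → Ω → ℝ) (l : ℕ) (m : ℤ)
    (s : ℝ≥0) (ω : Ω) : ℂ :=
  fieldCoeff A (fun i l' m' ↦ β i l' m' s ω) l m

/-! ### The Wiener integral -/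

/-- The step function `∑_{k<n} c_k 1_{(τ_k, τ_{k+1}]}`. -/
def stepFun (n : ℕ) (τ : ℕ → ℝ≥0) (c : ℕ → ℝ) (s : ℝ) : ℝ :=
  ∑ k ∈ Finset.range n, Set.indicator (Set.Ioc (τ k : ℝ) (τ (k + 1) : ℝ)) (fun _ ↦ c k) s

/-- The elementary integral `∑_{k<n} c_k (Z(τ_{k+1}) - Z(τ_k))` of a step function. -/
def stepIntegral {Ω : Type*} (n : ℕ) (τ : ℕ → ℝ≥0) (c : ℕ → ℝ) (Z : ℝ≥0 → Ω → ℂ) (ω : Ω) : ℂ :=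
  ∑ k ∈ Finset.range n, (c k : ℂ) * (Z (τ (k + 1)) ω - Z (τ k) ω)

/-- `X` is (a version of) the Wiener integral `∫₀ᵗ f(s) dZ(s)` of a deterministic integrand `f`: it
is the limit in `L²(P)` of the elementary integrals of step functions that converge to `f` in
`L²(0,t)`. (If `Z` is a multiple of a Brownian motion, or a combination of independent ones, the
elementary integral is a multiple of an isometry, so `X` is a.s. unique.) -/
def IsWienerIntegral {Ω : Type*} [MeasurableSpace Ω] (Z : ℝ≥0 → Ω → ℂ) (f : ℝ → ℝ) (t : ℝ≥0)
    (P : Measure Ω) (X : Ω → ℂ) : Prop :=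
  MemLp X 2 P ∧ ∀ ε : ℝ≥0∞, 0 < ε → ∃ (n : ℕ) (τ : ℕ → ℝ≥0) (c : ℕ → ℝ),
    Monotone τ ∧ τ n ≤ t ∧
    eLpNorm (fun s ↦ f s - stepFun n τ c s) 2 (volume.restrict (Set.Icc 0 (t : ℝ))) < ε ∧
    eLpNorm (fun ω ↦ X ω - stepIntegral n τ c Z ω) 2 P < ε

open Classical in
/-- The Wiener integral `∫₀ᵗ f(s) dZ(s)`, in a chosen version. -/
def wienerIntegral {Ω : Type*} [MeasurableSpace Ω] (Z : ℝ≥0 → Ω → ℂ) (f : ℝ → ℝ) (t : ℝ≥0)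
    (P : Measure Ω) : Ω → ℂ :=
  if h : ∃ X, IsWienerIntegral Z f t P X then h.choose else 0

/-! ### The stochastic convolution -/

/-- The eigenvalue `l(l+1)`. -/
def lam (l : ℕ) : ℝ := (l : ℝ) * ((l : ℝ) + 1)

/-- The two components of `R^l(t)`, `l ≠ 0`. -/
def waveKernel (l : ℕ) (j : Fin 2) (t : ℝ) : ℝ :=
  ![(Real.sqrt (lam l))⁻¹ * Real.sin (t * Real.sqrt (lam l)), Real.cos (t * Real.sqrt (lam l))] j

/-- The coefficient pair `Ŵ^{l,m}(t)` of the stochastic convolution: `∫₀ᵗ R^l(t-s) da^{l,m}(s)` for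
`l ≠ 0`, and `(∫₀ᵗ a^{0,0}(s) ds, a^{0,0}(t))` (a pathwise Lebesgue integral) for `l = 0`. -/
def convCoeff {Ω : Type*} [MeasurableSpace Ω] (A : ℕ → ℝ) (β : Fin 2 → ℕ → ℕ → ℝ≥0 → Ω → ℝ)
    (P : Measure Ω) (t : ℝ≥0) (l : ℕ) (m : ℤ) (j : Fin 2) : Ω → ℂ :=
  if l = 0 then
    fun ω ↦ ![∫ s in (0 : ℝ)..(t : ℝ), noiseCoeff A β l m s.toNNReal ω, noiseCoeff A β l m t ω] j
  else
    wienerIntegral (noiseCoeff A β l m) (fun s ↦ waveKernel l j ((t : ℝ) - s)) t P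

/-- The `ℝ²`-valued random field `Z` is the sum of a series with partial sums `S N`: `Z` is a random
field (jointly measurable), the series converges to it in `L²(Ω)` at every point of the sphere, and
in `L²(Ω; L²(S²))`. -/
structure IsFieldSum {Ω 𝕜 : Type*} [MeasurableSpace Ω] [RCLike 𝕜]
    (S : ℕ → Fin 2 → S2 → Ω → 𝕜) (Z : Fin 2 → S2 → Ω → ℝ) (P : Measure Ω) : Prop where
  measurable : ∀ j, Measurable fun q : Ω × S2 ↦ Z j q.2 q.1
  tendsto_eval : ∀ j y,
    Tendsto (fun N ↦ eLpNorm (fun ω ↦ S N j y ω - (Z j y ω : 𝕜)) 2 P) atTop (𝓝 0)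
  tendsto_L2 : ∀ j,
    Tendsto (fun N ↦ eLpNorm (fun q : Ω × S2 ↦ S N j q.2 q.1 - (Z j q.2 q.1 : 𝕜)) 2
      (P.prod surfaceMeasure)) atTop (𝓝 0)

/-- The random field `Z` is the stochastic convolution `Ŵ(t) = ∑_l ∑_m Ŵ^{l,m}(t) Y_{l,m}`. -/
def IsStochConv {Ω : Type*} [MeasurableSpace Ω] (A : ℕ → ℝ)
    (β : Fin 2 → ℕ → ℕ → ℝ≥0 → Ω → ℝ) (P : Measure Ω) (t : ℝ≥0) (Z : Fin 2 → S2 → Ω → ℝ) : Prop :=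
  IsFieldSum (fun N j y ω ↦ complexExpansion (fun l m ↦ convCoeff A β P t l m j ω) N y) Z P

/-! ### The covariance matrices -/

/-- The matrices `C_l(t)`. -/
def covMatrix (l : ℕ) (t : ℝ) : Matrix (Fin 2) (Fin 2) ℝ :=
  if l = 0 then !![t ^ 3 / 3, t ^ 2 / 2; t ^ 2 / 2, t]
  else
    !![(2 * lam l ^ (1 / 2 : ℝ) * t - Real.sin (2 * lam l ^ (1 / 2 : ℝ) * t)) /
          (4 * lam l ^ (3 / 2 : ℝ)),
        Real.sin (lam l ^ (1 / 2 : ℝ) * t) ^ 2 / (2 * lam l);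
        Real.sin (lam l ^ (1 / 2 : ℝ) * t) ^ 2 / (2 * lam l),
        (2 * lam l ^ (1 / 2 : ℝ) * t + Real.sin (2 * lam l ^ (1 / 2 : ℝ) * t)) /
          (4 * lam l ^ (1 / 2 : ℝ))]

/-- `D` is a Cholesky factor of `C`: lower triangular with nonnegative diagonal and `D Dᵀ = C`. -/
structure IsCholeskyFactor (D C : Matrix (Fin 2) (Fin 2) ℝ) : Prop where
  lower : ∀ i j, i < j → D i j = 0
  diag_nonneg : ∀ i, 0 ≤ D i i
  mul_transpose : D * D.transpose = C

/-- The `j`-th component of `β̂_i^{l,m} = D_l X_i^{l,m}`. -/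
def cholWeight {Ω : Type*} (D : ℕ → Matrix (Fin 2) (Fin 2) ℝ)
    (X : Fin 2 → ℕ → ℕ → Fin 2 → Ω → ℝ) (ω : Ω) (j : Fin 2) (i : Fin 2) (l m : ℕ) : ℝ :=
  (D l).mulVec (fun k ↦ X i l m k ω) j

theorem sphHarm_neg (l m : ℕ) (hm : 1 ≤ m) (y : S2) :
    sphHarm l (-(m : ℤ)) y = (-1) ^ m * (starRingEnd ℂ) (sphHarm l m y) := by
  have h : ¬ (0 : ℤ) ≤ -(m : ℤ) := by omega
  simp only [sphHarm, sphHarmAngle, if_neg h, Int.natAbs_neg, Int.natAbs_natCast,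
    Int.natCast_nonneg, if_true]

theorem sum_Icc_neg_eq (f : ℤ → ℂ) (l : ℕ) :
    ∑ m ∈ Finset.Icc (-(l : ℤ)) (l : ℤ), f m =
      f 0 + ∑ m ∈ Finset.Icc 1 l, (f m + f (-(m : ℤ))) := by
  induction l with
  | zero => simp
  | succ l ih =>
    have h : Finset.Icc (-((l + 1 : ℕ) : ℤ)) ((l + 1 : ℕ) : ℤ) =
        insert ((l + 1 : ℕ) : ℤ) (insert (-((l + 1 : ℕ) : ℤ)) (Finset.Icc (-(l : ℤ)) (l : ℤ))) := by
      ext x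
      simp only [Finset.mem_Icc, Finset.mem_insert]
      omega
    rw [h, Finset.sum_insert, Finset.sum_insert, ih, Finset.sum_Icc_succ_top (by omega)]
    · ring
    · simp only [Finset.mem_Icc]
      omega
    · simp only [Finset.mem_Icc, Finset.mem_insert]
      omega

/-- The complex expansion with coefficients `fieldCoeff A b` is the real expansion with weights
`b`. -/
theorem complexExpansion_fieldCoeff (A : ℕ → ℝ) (b : Fin 2 → ℕ → ℕ → ℝ) (N : ℕ) (y : S2) :
    complexExpansion (fieldCoeff A b) N y = (realExpansion A b N y : ℂ) := by
  simp only [complexExpansion, realExpansion, Complex.ofReal_sum]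
  refine Finset.sum_congr rfl fun l _ ↦ ?_
  rw [sum_Icc_neg_eq, Complex.ofReal_add, Complex.ofReal_mul, Complex.ofReal_mul _ (Finset.sum _ _),
    Complex.ofReal_sum, Finset.mul_sum]
  congr 1
  · have h : sphHarm l 0 y = ((sphHarm l 0 y).re : ℂ) := by
      simp [sphHarm, sphHarmAngle]
    rw [h]
    simp [fieldCoeff]
  · refine Finset.sum_congr rfl fun m hm ↦ ?_
    have hm1 : 1 ≤ m := (Finset.mem_Icc.mp hm).1
    have h0 : (m : ℤ) ≠ 0 := by omega
    have h1 : (0 : ℤ) < m := by omega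
    have h2 : -(m : ℤ) ≠ 0 := by omega
    have h3 : ¬ (0 : ℤ) < -(m : ℤ) := by omega
    have hs : (Real.sqrt (2 * A l) : ℂ) = 2 * (Real.sqrt (A l / 2) : ℂ) := by
      have : 2 * A l = 2 ^ 2 * (A l / 2) := by ring
      rw [this, Real.sqrt_mul (by norm_num), Real.sqrt_sq (by norm_num)]
      push_cast
      ring
    have hp : ((-1 : ℂ) ^ m) * (-1) ^ m = 1 := by
      rw [← mul_pow]
      norm_num
    rw [sphHarm_neg l m hm1, hs]
    simp only [fieldCoeff, if_neg h0, if_pos h1, if_neg h2, if_neg h3, Int.natAbs_neg,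
      Int.natAbs_natCast]
    generalize sphHarm l m y = z
    generalize (Real.sqrt (A l / 2) : ℂ) = r
    have e : ∀ w : ℂ, (-1) ^ m * r * w * ((-1) ^ m * (starRingEnd ℂ) z) =
        r * w * (starRingEnd ℂ) z := fun w ↦ by
      linear_combination r * w * (starRingEnd ℂ) z * hp
    rw [e]
    obtain ⟨u, v, rfl⟩ : ∃ u v : ℝ, z = u + v * Complex.I :=
      ⟨z.re, z.im, (Complex.re_add_im z).symm⟩
    simp only [map_add, map_mul, Complex.conj_ofReal, Complex.conj_I]
    simp
    linear_combination -2 * r * (b 1 l m : ℂ) * (v : ℂ) * Complex.I_sq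

end

/-! The theorem reduces to Hilbert space geometry in `L²`. The centered Gaussian variables form a
closed subset of `L²` (`isClosed_centeredGaussians`), so the closed span of a centered Gaussian
process consists of centered Gaussians. A family taken from such a span is a Gaussian process, and
its law is determined by its inner products (`identDistrib_of_inner_eq`). Gaussianity thus becomes
membership in a closed subspace, and equality in law becomes equality of covariances.

The correspondence between the indicator of `(0, s]` and the Brownian motion at time `s` preserves
inner products, because `(0, s]` and `(0, r]` overlap in length `min s r`. Its extension to
continuous integrands is the Wiener integral, and the Itô isometry expresses the covariances of the
convolution coefficients by integrals of products of kernel entries, which are the entries of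
`C_l(t)` (`integral_propagator_mul`). Integration by parts turns the time integral of a Brownian
path into the Wiener integral of `t - s`, so degree 0 follows the same pattern with the kernel `(u,
1)`.

For convergence, different modes are orthogonal in `L²`, and the addition theorem `sum_sq_sphHarm`
makes the sum over `m` of the squared harmonics of degree `l` equal to `(2l+1)/(4π)` at every point.
As the diagonals of `C_l(t)` are bounded in `l`, the increments of the partial sums are controlled
by the tail of `∑ (2l+1) A_l`, uniformly over the sphere. This yields both modes of convergence and
a jointly measurable sum.

Finally, `D X` has covariance `D Dᵀ` for a standard normal vector `X`. The convolution weights and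
the weights `D_l X` are therefore instances of `IsGaussianWeights` with the same matrices, and
fields and coefficients have the same laws. -/

/-! ### Gaussian subspaces of `L²` -/

section GaussianHilbert

variable {Ω Ω' : Type*} [MeasurableSpace Ω] [MeasurableSpace Ω']
  {P : Measure Ω} [IsProbabilityMeasure P] {P' : Measure Ω'} [IsProbabilityMeasure P']

/-- The centered Gaussian elements of `L²(P)`, described by their characteristic functions. -/
def centeredGaussians (P : Measure Ω) : Set (Lp ℝ 2 P) :=
  {f | ∀ s : ℝ, ∫ ω, Complex.exp ((s * f ω : ℝ) * Complex.I) ∂P =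
    Complex.exp ((-(s ^ 2 * ‖f‖ ^ 2 / 2) : ℝ))}

theorem integrable_cexp_mul_I {X : Ω → ℝ} (hX : AEMeasurable X P) :
    Integrable (fun ω ↦ Complex.exp ((X ω : ℝ) * Complex.I)) P := by
  refine Integrable.of_bound (C := 1) ?_ (ae_of_all _ fun ω ↦ ?_)
  · exact (by fun_prop : AEMeasurable _ P).aestronglyMeasurable
  · rw [Complex.norm_exp_ofReal_mul_I]

/-- Follows from `|e^{ia} - e^{ib}| ≤ |a - b|` and from the `L¹` norm being at most the `L²` norm on
a probability space. -/
theorem norm_integral_cexp_sub_le (f g : Lp ℝ 2 P) (s : ℝ) :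
    ‖∫ ω, Complex.exp ((s * f ω : ℝ) * Complex.I) ∂P -
      ∫ ω, Complex.exp ((s * g ω : ℝ) * Complex.I) ∂P‖ ≤ |s| * ‖f - g‖ := by
  have hf : AEMeasurable f P := (Lp.aestronglyMeasurable f).aemeasurable
  have hg : AEMeasurable g P := (Lp.aestronglyMeasurable g).aemeasurable
  rw [← integral_sub (integrable_cexp_mul_I (by fun_prop)) (integrable_cexp_mul_I (by fun_prop))]
  have hd : MemLp (⇑(f - g)) 2 P := Lp.memLp _
  have h1 : MemLp (⇑(f - g)) 1 P := hd.mono_exponent (by norm_num)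
  have hi := memLp_one_iff_integrable.1 h1
  have hle : ∫ ω, ‖(f - g) ω‖ ∂P ≤ ‖f - g‖ := by
    rw [Lp.norm_def, integral_norm_eq_lintegral_enorm hi.aestronglyMeasurable]
    refine ENNReal.toReal_mono hd.eLpNorm_ne_top ?_
    rw [← eLpNorm_one_eq_lintegral_enorm]
    exact eLpNorm_le_eLpNorm_of_exponent_le (by norm_num) hi.aestronglyMeasurable
  calc _ ≤ ∫ ω, |s| * ‖(f - g) ω‖ ∂P := by
        refine norm_integral_le_of_norm_le (hi.norm.const_mul _) ?_
        filter_upwards [Lp.coeFn_sub f g] with ω hω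
        rw [hω, Pi.sub_apply]
        have := Real.norm_exp_I_mul_ofReal_sub_one_le (x := s * f ω - s * g ω)
        have e : Complex.exp ((s * f ω : ℝ) * Complex.I) - Complex.exp ((s * g ω : ℝ) * Complex.I)
            = Complex.exp ((s * g ω : ℝ) * Complex.I) *
              (Complex.exp (Complex.I * (s * f ω - s * g ω : ℝ)) - 1) := by
          rw [mul_sub, ← Complex.exp_add, mul_one]
          congr 2
          push_cast
          ring
        rw [e, norm_mul, Complex.norm_exp_ofReal_mul_I, one_mul]
        refine this.trans (le_of_eq ?_)
        rw [← mul_sub, norm_mul, Real.norm_eq_abs]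
    _ ≤ _ := by
        rw [integral_const_mul]
        exact mul_le_mul_of_nonneg_left hle (abs_nonneg _)

/-- For each `s` both sides of the defining equation are continuous in `f`: the characteristic
function is Lipschitz, and the variance is the squared norm. -/
theorem isClosed_centeredGaussians : IsClosed (centeredGaussians P) := by
  simp only [centeredGaussians, Set.ofPred_forall]
  refine isClosed_iInter fun s ↦ isClosed_eq ?_ (by fun_prop)
  refine (LipschitzWith.of_dist_le_mul (K := ⟨|s|, abs_nonneg s⟩) fun f g ↦ ?_).continuous
  rw [dist_eq_norm, dist_eq_norm]
  exact norm_integral_cexp_sub_le f g s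

omit [IsProbabilityMeasure P] in
theorem norm_toLp_sq {X : Ω → ℝ} (hX : MemLp X 2 P) : ‖hX.toLp X‖ ^ 2 = ∫ ω, X ω ^ 2 ∂P := by
  rw [← real_inner_self_eq_norm_sq, L2.inner_def]
  refine integral_congr_ae ?_
  filter_upwards [hX.coeFn_toLp] with ω h
  rw [h]
  simp [sq]

omit [IsProbabilityMeasure P] in
theorem inner_toLp {X Y : Ω → ℝ} (hX : MemLp X 2 P) (hY : MemLp Y 2 P) :
    inner ℝ (hX.toLp X) (hY.toLp Y) = ∫ ω, X ω * Y ω ∂P := by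
  rw [L2.inner_def]
  refine integral_congr_ae ?_
  filter_upwards [hX.coeFn_toLp, hY.coeFn_toLp] with ω h h'
  rw [h, h']
  simp [mul_comm]

omit [IsProbabilityMeasure P] in
theorem HasGaussianLaw.toLp_mem_centeredGaussians {X : Ω → ℝ} (hX : HasGaussianLaw X P)
    (h0 : ∫ ω, X ω ∂P = 0) : hX.memLp_two.toLp X ∈ centeredGaussians P := by
  intro s
  have h := charFun_gaussianReal (μ := P[X]) (v := Var[X; P].toNNReal) s
  rw [← hX.map_eq_gaussianReal, charFun_apply_real, integral_map hX.aemeasurable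
    (by fun_prop)] at h
  rw [norm_toLp_sq]
  have hv : Var[X; P] = ∫ ω, X ω ^ 2 ∂P := by
    rw [variance_of_integral_eq_zero hX.aemeasurable h0]
  have e : ∫ ω, Complex.exp ((s * (hX.memLp_two.toLp X) ω : ℝ) * Complex.I) ∂P =
      ∫ ω, Complex.exp (s * X ω * Complex.I) ∂P := by
    refine integral_congr_ae ?_
    filter_upwards [hX.memLp_two.coeFn_toLp] with ω h
    rw [h]
    push_cast
    rfl
  rw [e, h, Real.coe_toNNReal _ (variance_nonneg _ _), h0, hv]
  congr 1
  push_cast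
  ring

theorem map_eq_of_mem_centeredGaussians {f : Lp ℝ 2 P} (hf : f ∈ centeredGaussians P) :
    P.map f = gaussianReal 0 (‖f‖₊ ^ 2) := by
  have hm : AEMeasurable f P := (Lp.aestronglyMeasurable f).aemeasurable
  have := Measure.isProbabilityMeasure_map (μ := P) hm
  refine Measure.ext_of_charFun (funext fun s ↦ ?_)
  rw [charFun_gaussianReal, charFun_apply_real, integral_map hm (by fun_prop)]
  have := hf s
  push_cast at this
  rw [this]
  congr 1
  push_cast
  ring

theorem integral_eq_zero_of_mem_centeredGaussians {f : Lp ℝ 2 P} (hf : f ∈ centeredGaussians P) :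
    ∫ ω, f ω ∂P = 0 := by
  have hm : AEMeasurable f P := (Lp.aestronglyMeasurable f).aemeasurable
  have h : ∫ x, x ∂(P.map f) = ∫ ω, f ω ∂P := integral_map hm (by fun_prop)
  rw [← h, map_eq_of_mem_centeredGaussians hf, integral_id_gaussianReal]

/-- The classes of the values of a process whose values are square integrable. -/
noncomputable def processLp {ι : Type*} {Y : ι → Ω → ℝ} (hY : ∀ i, MemLp (Y i) 2 P) (i : ι) :
    Lp ℝ 2 P :=
  (hY i).toLp (Y i)

/-- Finite linear combinations are Gaussian by joint Gaussianity, and closedness carries this over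
to their limits. -/
theorem span_processLp_subset {ι : Type*} {Y : ι → Ω → ℝ} (hY : IsGaussianProcess Y P)
    (h0 : ∀ i, ∫ ω, Y i ω ∂P = 0) (hL : ∀ i, MemLp (Y i) 2 P) :
    ((Submodule.span ℝ (Set.range (processLp hL))).topologicalClosure : Set (Lp ℝ 2 P)) ⊆
      centeredGaussians P := by
  rw [Submodule.topologicalClosure_coe]
  refine closure_minimal (fun f hf ↦ ?_) isClosed_centeredGaussians
  obtain ⟨c, rfl⟩ := Finsupp.mem_span_range_iff_exists_finsupp.1 hf
  have hG : HasGaussianLaw (fun ω ↦ ∑ i ∈ c.support, c i • Y i ω) P :=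
    (hY.smul c).hasGaussianLaw_fun_sum
  have hz : ∫ ω, ∑ i ∈ c.support, c i • Y i ω ∂P = 0 := by
    rw [integral_finsetSum (f := fun i ω ↦ c i • Y i ω) _
      fun i _ ↦ ((hL i).integrable (by norm_num)).smul (c i)]
    simp_rw [integral_smul, h0, smul_zero, Finset.sum_const_zero]
  have := HasGaussianLaw.toLp_mem_centeredGaussians hG hz
  convert this using 1
  ext1
  refine EventuallyEq.trans ?_ hG.memLp_two.coeFn_toLp.symm
  refine (Lp.coeFn_finsetSum _ _).trans ?_
  have h1 : ∀ᵐ ω ∂P, ∀ i ∈ c.support, (c i • processLp hL i : Lp ℝ 2 P) ω = c i • Y i ω := by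
    refine (ae_ball_iff c.support.countable_toSet).2 fun i _ ↦ ?_
    filter_upwards [Lp.coeFn_smul (c i) (processLp hL i), (hL i).coeFn_toLp] with ω h h'
    rw [h, Pi.smul_apply, processLp, h']
  filter_upwards [h1] with ω h
  rw [Finset.sum_apply]
  exact Finset.sum_congr rfl h

omit [IsProbabilityMeasure P] in
-- The formula for `L x` pins down the coefficients, so that two processes tested against the same
-- functional are seen to receive the same ones.
theorem dual_restrict_ae_eq {ι : Type*} {F : ι → Lp ℝ 2 P} {Z : ι → Ω → ℝ}
    (hZ : ∀ i, Z i =ᵐ[P] F i) (I : Finset ι) (L : StrongDual ℝ (I → ℝ)) :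
    ∃ c : I → ℝ, (∀ x, L x = ∑ i, c i * x i) ∧
      (fun ω ↦ L (I.restrict (Z · ω))) =ᵐ[P] ((∑ i : I, c i • F i : Lp ℝ 2 P) : Ω → ℝ) := by
  classical
  refine ⟨fun i ↦ L (Pi.single i 1), fun x ↦ ?_, ?_⟩
  · conv_lhs => rw [pi_eq_sum_univ' x, map_sum]
    refine Finset.sum_congr rfl fun i _ ↦ ?_
    rw [map_smul, smul_eq_mul, mul_comm]
  · refine EventuallyEq.trans ?_ (Lp.coeFn_finsetSum _ _).symm
    have h1 : ∀ᵐ ω ∂P, ∀ i : I, (L (Pi.single i 1) • F i : Lp ℝ 2 P) ω =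
        L (Pi.single i 1) * Z i ω := by
      refine ae_all_iff.2 fun i ↦ ?_
      filter_upwards [Lp.coeFn_smul (L (Pi.single i 1)) (F i), hZ i] with ω h h'
      rw [h, Pi.smul_apply, h', smul_eq_mul]
    filter_upwards [h1] with ω h
    conv_lhs => rw [pi_eq_sum_univ' (I.restrict (Z · ω)), map_sum]
    rw [Finset.sum_apply]
    refine Finset.sum_congr rfl fun i _ ↦ ?_
    rw [h, map_smul, smul_eq_mul, mul_comm]
    rfl

/-- Cramér–Wold: a linear functional of finitely many values is again an element of `V`, hence
Gaussian. -/
theorem isGaussianProcess_of_mem_centeredGaussians {ι : Type*} {V : Submodule ℝ (Lp ℝ 2 P)}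
    (hV : (V : Set (Lp ℝ 2 P)) ⊆ centeredGaussians P) {F : ι → Lp ℝ 2 P} (hF : ∀ i, F i ∈ V)
    {Z : ι → Ω → ℝ} (hZ : ∀ i, Z i =ᵐ[P] F i) : IsGaussianProcess Z P := by
  refine ⟨fun I ↦ ⟨isGaussian_of_map_eq_gaussianReal fun L ↦ ?_⟩⟩
  have hm : AEMeasurable (fun ω ↦ I.restrict (Z · ω)) P :=
    aemeasurable_pi_lambda _ fun i ↦
      (Lp.aestronglyMeasurable (F i)).aemeasurable.congr (hZ i).symm
  obtain ⟨c, -, hc⟩ := dual_restrict_ae_eq hZ I L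
  refine ⟨0, ‖(∑ i : I, c i • F i : Lp ℝ 2 P)‖₊ ^ 2, ?_⟩
  rw [AEMeasurable.map_map_of_aemeasurable (by fun_prop) hm]
  rw [← map_eq_of_mem_centeredGaussians
    (hV (V.sum_mem fun i _ ↦ V.smul_mem (c i) (hF i)))]
  exact Measure.map_congr hc

/-- Finite-dimensional laws determine the law on the product space. The characteristic function of
such a law at a functional depends only on the norm of a linear combination, which the inner
products determine. -/
theorem identDistrib_of_inner_eq {ι : Type*} {V : Submodule ℝ (Lp ℝ 2 P)}
    (hV : (V : Set (Lp ℝ 2 P)) ⊆ centeredGaussians P) {F : ι → Lp ℝ 2 P} (hF : ∀ i, F i ∈ V)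
    {V' : Submodule ℝ (Lp ℝ 2 P')} (hV' : (V' : Set (Lp ℝ 2 P')) ⊆ centeredGaussians P')
    {F' : ι → Lp ℝ 2 P'} (hF' : ∀ i, F' i ∈ V')
    (hinner : ∀ i j, inner ℝ (F i) (F j) = inner ℝ (F' i) (F' j))
    {Z : ι → Ω → ℝ} (hZ : ∀ i, Z i =ᵐ[P] F i) {Z' : ι → Ω' → ℝ} (hZ' : ∀ i, Z' i =ᵐ[P'] F' i)
    (hm : AEMeasurable (fun ω i ↦ Z i ω) P) (hm' : AEMeasurable (fun ω i ↦ Z' i ω) P') :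
    IdentDistrib (fun ω i ↦ Z i ω) (fun ω i ↦ Z' i ω) P P' := by
  refine ⟨hm, hm', ?_⟩
  have h1 := isProjectiveLimit_map hm
  refine h1.unique fun I ↦ ?_
  rw [isProjectiveLimit_map hm' I]
  have hmI : AEMeasurable (fun ω ↦ I.restrict (Z · ω)) P :=
    (Finset.measurable_restrict I).comp_aemeasurable hm
  have hmI' : AEMeasurable (fun ω ↦ I.restrict (Z' · ω)) P' :=
    (Finset.measurable_restrict I).comp_aemeasurable hm'
  have := Measure.isProbabilityMeasure_map hmI
  have := Measure.isProbabilityMeasure_map hmI'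
  refine Measure.ext_of_charFunDual (funext fun L ↦ ?_)
  obtain ⟨c, hLc, hc⟩ := dual_restrict_ae_eq hZ I L
  obtain ⟨c', hLc', hc'⟩ := dual_restrict_ae_eq hZ' I L
  classical
  have hcc : c = c' := by
    funext i
    simpa [Pi.single_apply] using (hLc (Pi.single i 1)).symm.trans (hLc' (Pi.single i 1))
  subst hcc
  rw [charFunDual_apply, charFunDual_apply, integral_map hmI (by fun_prop),
    integral_map hmI' (by fun_prop)]
  -- The argument `1` suffices, because `L` ranges over all functionals and absorbs any scaling.
  have hg := hV (V.sum_mem (t := Finset.univ) fun (i : I) _ ↦ V.smul_mem (c i) (hF i)) 1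
  have hg' := hV' (V'.sum_mem (t := Finset.univ) fun (i : I) _ ↦ V'.smul_mem (c i) (hF' i)) 1
  have hn : ‖(∑ i : I, c i • F i : Lp ℝ 2 P)‖ ^ 2 = ‖(∑ i : I, c i • F' i : Lp ℝ 2 P')‖ ^ 2 := by
    simp_rw [← real_inner_self_eq_norm_sq, sum_inner, inner_sum, real_inner_smul_left,
      real_inner_smul_right, hinner]
  rw [← hn, ← hg] at hg'
  refine Eq.trans ?_ (hg'.trans ?_)
  · refine integral_congr_ae ?_
    filter_upwards [hc'] with ω h
    simp only [one_mul, ← h]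
  · refine integral_congr_ae ?_
    filter_upwards [hc] with ω h
    simp only [one_mul, ← h]

end GaussianHilbert

/-! ### Legendre's equation and the addition theorem on the diagonal -/

section AdditionTheorem

open Polynomial in
-- With `u = (X² - 1)^l`, this is `(X² - 1) u' = 2 l X u` differentiated `n + 1` times: once in the
-- base case and once more in each inductive step.
theorem iterate_derivative_X_sq_sub_one_pow (l n : ℕ) :
    (X ^ 2 - 1 : ℝ[X]) * derivative^[n + 2] ((X ^ 2 - 1) ^ l) +
        2 * ((n : ℝ[X]) + 1) * X * derivative^[n + 1] ((X ^ 2 - 1) ^ l) +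
        ((n : ℝ[X]) + 1) * (n : ℝ[X]) * derivative^[n] ((X ^ 2 - 1) ^ l) =
      2 * (l : ℝ[X]) * X * derivative^[n + 1] ((X ^ 2 - 1) ^ l) +
        2 * (l : ℝ[X]) * ((n : ℝ[X]) + 1) * derivative^[n] ((X ^ 2 - 1) ^ l) := by
  induction n with
  | zero =>
    have h : (X ^ 2 - 1 : ℝ[X]) * derivative ((X ^ 2 - 1) ^ l) = 2 * (l : ℝ[X]) * X * (X ^ 2 - 1) ^ l := by
      rw [derivative_pow]
      rcases l with _ | l
      · simp
      · simp only [derivative_sub, derivative_one, pow_succ]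
        simp
        ring
    have h' := congrArg derivative h
    simp only [derivative_mul, derivative_sub, derivative_X_pow, derivative_one, derivative_X,
      derivative_natCast, derivative_ofNat] at h'
    simp only [Function.iterate_succ', Function.comp, Function.iterate_zero, id]
    push_cast at h' ⊢
    simp only [map_ofNat] at h'
    linear_combination h'
  | succ n ih =>
    have h' := congrArg derivative ih
    simp only [derivative_mul, derivative_sub, derivative_X_pow, derivative_one, derivative_X,
      derivative_natCast, derivative_ofNat, derivative_add, ← Function.iterate_succ_apply'] at h'
    push_cast at h' ⊢
    simp only [map_ofNat] at h'
    simp only [Nat.succ_eq_add_one] at h'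
    linear_combination h'

open Polynomial in
/-- The differentiated Legendre equation. -/
theorem iterate_derivative_legendreP (l m : ℕ) :
    (X ^ 2 - 1 : ℝ[X]) * derivative^[m + 2] (legendreP l) +
        2 * ((m : ℝ[X]) + 1) * X * derivative^[m + 1] (legendreP l) =
      ((l : ℝ[X]) + ((m : ℝ[X]) + 1)) * ((l : ℝ[X]) - (m : ℝ[X])) * derivative^[m] (legendreP l) := by
  have e : ∀ k, derivative^[k] (legendreP l) = C ((2 : ℝ) ^ l * (l.factorial : ℝ))⁻¹ *
      derivative^[k + l] ((X ^ 2 - 1) ^ l) := fun k ↦ by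
    rw [legendreP, iterate_derivative_C_mul, ← Function.iterate_add_apply]
  -- Rodrigues' formula shifts the order of differentiation by `l`. For `n = m + l` the coefficients
  -- combine to `2(m + 1)` and `(l + m + 1)(l - m)`.
  have h := iterate_derivative_X_sq_sub_one_pow l (m + l)
  rw [e, e, e, show m + 2 + l = m + l + 2 by ring, show m + 1 + l = m + l + 1 by ring]
  push_cast at h ⊢
  linear_combination C ((2 : ℝ) ^ l * (l.factorial : ℝ))⁻¹ * h

open Polynomial in
-- Around the point 1 the polynomial `X² - 1` becomes `(X + 2) X`, so the Taylor coefficient of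
-- order `l` of its `l`-th power is `2^l`, which the normalization cancels.
theorem legendreP_eval_one (l : ℕ) : (legendreP l).eval 1 = 1 := by
  have h : (hasseDeriv l ((X ^ 2 - 1 : ℝ[X]) ^ l)).eval 1 = 2 ^ l := by
    rw [← taylor_coeff, taylor_pow]
    have : taylor 1 (X ^ 2 - 1 : ℝ[X]) = (X + 2) * X := by
      simp [taylor_apply]
      ring
    rw [this, mul_pow, coeff_mul_X_pow']
    simp [coeff_zero_eq_eval_zero]
  have hd := congrFun (factorial_smul_hasseDeriv (R := ℝ) l) ((X ^ 2 - 1) ^ l)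
  rw [legendreP, ← hd, eval_mul, eval_C, LinearMap.smul_apply, eval_smul, h, nsmul_eq_mul]
  have : (l.factorial : ℝ) ≠ 0 := by positivity
  field_simp

open Polynomial in
theorem iterate_derivative_legendreP_eq_zero (l : ℕ) :
    derivative^[l + 1] (legendreP l) = 0 := by
  rw [legendreP, iterate_derivative_C_mul, ← Function.iterate_add_apply,
    iterate_derivative_eq_zero, mul_zero]
  refine (natDegree_pow_le).trans_lt ?_
  have : natDegree (X ^ 2 - 1 : ℝ[X]) ≤ 2 := by compute_degree
  nlinarith

open Polynomial in
-- The derivative of the `m`-th summand is a difference of consecutive terms `G`. The sum telescopes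
-- to `G l - G 0`, where `G l = 0` and `G 0 = P_l P_l'`, and this cancels the derivative of `P_l²`.
-- The left side is thus constant, and at `1` only `P_l(1)² = 1` survives.
theorem sum_sq_iterate_derivative_legendreP (l : ℕ) :
    (legendreP l) ^ 2 + 2 * ∑ m ∈ Finset.range l,
      C (((l - (m + 1)).factorial : ℝ) / (l + (m + 1)).factorial) * (1 - X ^ 2) ^ (m + 1) *
        (derivative^[m + 1] (legendreP l)) ^ 2 = 1 := by
  set F := (legendreP l) ^ 2 + 2 * ∑ m ∈ Finset.range l,
      C (((l - (m + 1)).factorial : ℝ) / (l + (m + 1)).factorial) * (1 - X ^ 2) ^ (m + 1) *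
        (derivative^[m + 1] (legendreP l)) ^ 2 with hF
  set G : ℕ → ℝ[X] := fun m ↦ C (((l - m).factorial : ℝ) / (l + m).factorial) *
    (1 - X ^ 2) ^ m * derivative^[m] (legendreP l) * derivative^[m + 1] (legendreP l) with hG
  have key : ∀ m ∈ Finset.range l,
      derivative (C (((l - (m + 1)).factorial : ℝ) / (l + (m + 1)).factorial) *
        (1 - X ^ 2) ^ (m + 1) * (derivative^[m + 1] (legendreP l)) ^ 2) =
      G (m + 1) - G m := by
    intro m hm
    have hml : m < l := Finset.mem_range.1 hm
    -- The ratio of consecutive normalizations is exactly the factor `(l + m + 1)(l - m)` of the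
    -- differentiated Legendre equation, which is why the derivatives telescope.
    have hc : C (((l - m).factorial : ℝ) / (l + m).factorial) =
        (l + (m + 1)) * (l - m) * C (((l - (m + 1)).factorial : ℝ) / (l + (m + 1)).factorial) := by
      have e1 : (l : ℝ[X]) = C (l : ℝ) := by simp
      have e2 : (m : ℝ[X]) = C (m : ℝ) := by simp
      rw [e1, e2, ← C_1, ← C_add, ← C_add, ← C_sub, ← C_mul, ← C_mul]
      congr 1
      have f1 : (l - m).factorial = (l - m) * (l - (m + 1)).factorial := by
        rw [← Nat.mul_factorial_pred (by omega)]
        congr 2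
      have f2 : (l + (m + 1)).factorial = (l + (m + 1)) * (l + m).factorial := by
        rw [← add_assoc, Nat.factorial_succ]
      rw [f1, f2]
      have : ((l + m).factorial : ℝ) ≠ 0 := by positivity
      have : ((l : ℝ) + (m + 1)) ≠ 0 := by positivity
      push_cast [Nat.cast_sub hml.le]
      field_simp
    have ode := iterate_derivative_legendreP l m
    simp only [hG, hc, derivative_mul, derivative_C, derivative_pow, derivative_sub,
      derivative_one, derivative_X, ← Function.iterate_succ_apply', Nat.succ_eq_add_one]
    simp only [Nat.cast_add, Nat.cast_one, Nat.add_sub_cancel, map_add, map_natCast, map_one,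
      Nat.cast_ofNat, map_ofNat]
    rw [pow_succ (1 - X ^ 2 : ℝ[X]) m]
    linear_combination (-1) * C (((l - (m + 1)).factorial : ℝ) / (l + (m + 1)).factorial) *
      (1 - X ^ 2) ^ m * derivative^[m + 1] (legendreP l) * ode
  have hd : derivative F = 0 := by
    rw [hF, derivative_add, derivative_mul, derivative_sum, Finset.sum_congr rfl key,
      Finset.sum_range_sub]
    have h0 : G 0 = legendreP l * derivative (legendreP l) := by
      have : (l.factorial : ℝ) ≠ 0 := by positivity
      simp [hG, this]
    have h1 : G l = 0 := by
      simp only [hG, iterate_derivative_legendreP_eq_zero, mul_zero]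
    rw [h0, h1, derivative_pow]
    simp only [derivative_ofNat, Nat.cast_ofNat, map_ofNat]
    ring
  have hdeg := derivative_eq_zero.1 hd
  rw [eq_C_of_natDegree_eq_zero hdeg] at hF ⊢
  have h1 := congrArg (eval 1) hF
  rw [eval_C] at h1
  rw [h1]
  simp [eval_finsetSum, legendreP_eval_one]

theorem sum_sq_normLegendre (l : ℕ) (θ : ℝ) :
    normLegendre l 0 θ ^ 2 + 2 * ∑ m ∈ Finset.Icc 1 l, normLegendre l m θ ^ 2 =
      (2 * l + 1) / (4 * Real.pi) := by
  have h := congrArg (Polynomial.eval (Real.cos θ)) (sum_sq_iterate_derivative_legendreP l)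
  have hn : ∀ m, normLegendre l m θ ^ 2 = (2 * l + 1) / (4 * Real.pi) *
      (((l - m).factorial : ℝ) / (l + m).factorial * (1 - Real.cos θ ^ 2) ^ m *
        (Polynomial.derivative^[m] (legendreP l)).eval (Real.cos θ) ^ 2) := by
    intro m
    have h0 : 0 ≤ 1 - Real.cos θ ^ 2 := by nlinarith [Real.sin_sq_add_cos_sq θ, sq_nonneg (Real.sin θ)]
    rw [normLegendre, assocLegendre, mul_pow, Real.sq_sqrt (by positivity), mul_pow, mul_pow,
      pow_right_comm, neg_one_sq, one_pow, pow_right_comm (Real.sqrt _), Real.sq_sqrt h0]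
    ring
  have hI : ∀ f : ℕ → ℝ, ∑ m ∈ Finset.Icc 1 l, f m = ∑ m ∈ Finset.range l, f (m + 1) := fun f ↦ by
    rw [Finset.range_eq_Ico, Finset.sum_Ico_add' f 0 l 1]
    rfl
  rw [hI]
  simp_rw [hn]
  rw [← Finset.mul_sum]
  simp only [Polynomial.eval_add, Polynomial.eval_mul, Polynomial.eval_pow,
    Polynomial.eval_finsetSum, Polynomial.eval_C, Polynomial.eval_sub, Polynomial.eval_one,
    Polynomial.eval_X, Polynomial.eval_ofNat] at h
  have hl : (l.factorial : ℝ) ≠ 0 := by positivity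
  simp only [Nat.sub_zero, add_zero, div_self hl, pow_zero, Function.iterate_zero, id]
  linear_combination (2 * l + 1) / (4 * Real.pi) * h

theorem sphHarm_natCast (l m : ℕ) (y : S2) :
    sphHarm l m y = (normLegendre l m (Real.arccos (y.1 2)) : ℂ) *
      Complex.exp ((m * Complex.arg ⟨y.1 0, y.1 1⟩ : ℝ) * Complex.I) := by
  simp only [sphHarm, sphHarmAngle, Int.natCast_nonneg, if_true, Int.natAbs_natCast]
  congr 2
  push_cast
  ring

/-- The azimuth drops out through `cos² + sin² = 1`, leaving the Legendre identity. Independence of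
`y` is what makes all later estimates uniform over the sphere. -/
theorem sum_sq_sphHarm (l : ℕ) (y : S2) :
    (sphHarm l 0 y).re ^ 2 + 2 * ∑ m ∈ Finset.Icc 1 l,
      ((sphHarm l m y).re ^ 2 + (sphHarm l m y).im ^ 2) = (2 * l + 1) / (4 * Real.pi) := by
  rw [← sum_sq_normLegendre l (Real.arccos (y.1 2))]
  have h0 := sphHarm_natCast l 0 y
  simp only [Nat.cast_zero, zero_mul, Complex.ofReal_zero, Complex.exp_zero, mul_one] at h0
  rw [h0, Complex.ofReal_re]
  congr 2
  refine Finset.sum_congr rfl fun m _ ↦ ?_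
  rw [sphHarm_natCast, Complex.re_ofReal_mul, Complex.im_ofReal_mul, Complex.exp_ofReal_mul_I_re,
    Complex.exp_ofReal_mul_I_im]
  linear_combination normLegendre l m (Real.arccos (y.1 2)) ^ 2 *
    Real.cos_sq_add_sin_sq (m * Complex.arg ⟨y.1 0, y.1 1⟩)

theorem measurable_sphHarm_natCast (l m : ℕ) : Measurable (fun y : S2 ↦ sphHarm l m y) := by
  have hc : ∀ i : Fin 3, Measurable fun y : S2 ↦ y.1 i := fun i ↦
    ((EuclideanSpace.proj (𝕜 := ℝ) i).continuous.comp continuous_subtype_val).measurable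
  have ha : Measurable fun y : S2 ↦ Complex.arg ⟨y.1 0, y.1 1⟩ := by
    refine Complex.measurable_arg.comp ?_
    exact Complex.measurableEquivRealProd.symm.measurable.comp ((hc 0).prodMk (hc 1))
  have hn : Measurable fun y : S2 ↦ normLegendre l m (Real.arccos (y.1 2)) := by
    unfold normLegendre assocLegendre
    have := (hc 2)
    have hP := (Polynomial.derivative^[m] (legendreP l)).continuous.measurable
    fun_prop
  simp_rw [sphHarm_natCast]
  fun_prop

theorem sphHarm_sphPoint (l m : ℕ) {θ φ : ℝ} (hθ : θ ∈ Set.Icc 0 Real.pi) :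
    sphHarm l m (sphPoint θ φ) =
      (normLegendre l m θ : ℂ) * Complex.exp ((m * φ : ℝ) * Complex.I) := by
  rw [sphHarm_natCast]
  change (normLegendre l m (Real.arccos (Real.cos θ)) : ℂ) * Complex.exp ((m * Complex.arg
    ⟨Real.sin θ * Real.cos φ, Real.sin θ * Real.sin φ⟩ : ℝ) * Complex.I) = _
  rw [Real.arccos_cos hθ.1 hθ.2]
  -- At a pole the recovered azimuth is a default value. It is harmless: for `m = 0` it does not
  -- enter, and for `m ≥ 1` the power of `√(1 - cos² θ)` vanishes.
  rcases eq_or_lt_of_le (Real.sin_nonneg_of_mem_Icc hθ) with h | h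
  · rcases m with _ | m
    · simp
    · have : normLegendre l (m + 1) θ = 0 := by
        have hs : 1 - Real.cos θ ^ 2 = 0 := by
          have := Real.sin_sq_add_cos_sq θ
          rw [← h] at this
          linarith
        simp [normLegendre, assocLegendre, hs]
      simp [this]
  · have hz : (⟨Real.sin θ * Real.cos φ, Real.sin θ * Real.sin φ⟩ : ℂ) =
        (Real.sin θ : ℂ) * Complex.exp (φ * Complex.I) := by
      apply Complex.ext
      · rw [Complex.re_ofReal_mul, Complex.exp_ofReal_mul_I_re]
      · rw [Complex.im_ofReal_mul, Complex.exp_ofReal_mul_I_im]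
    -- The argument agrees with `φ` only modulo `2π`, so exponentials are compared instead of
    -- angles; the `m`-th power then gives the claim.
    have ha : Complex.exp ((Complex.arg ⟨Real.sin θ * Real.cos φ, Real.sin θ * Real.sin φ⟩ : ℝ) *
        Complex.I) = Complex.exp (φ * Complex.I) := by
      have hh := Complex.norm_mul_exp_arg_mul_I
        ⟨Real.sin θ * Real.cos φ, Real.sin θ * Real.sin φ⟩
      rw [hz] at hh ⊢
      rw [norm_mul, Complex.norm_exp_ofReal_mul_I, mul_one, Complex.norm_of_nonneg h.le] at hh
      exact mul_left_cancel₀ (by exact_mod_cast h.ne') hh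
    congr 1
    push_cast
    rw [mul_assoc, mul_assoc, Complex.exp_nat_mul, Complex.exp_nat_mul, ha]

theorem realExpansion_sphPoint (A : ℕ → ℝ) (b : Fin 2 → ℕ → ℕ → ℝ) (N : ℕ) {θ : ℝ}
    (hθ : θ ∈ Set.Icc 0 Real.pi) (φ : ℝ) :
    realExpansion A b N (sphPoint θ φ) = angularExpansion A b N θ φ := by
  have h0 := fun l ↦ sphHarm_sphPoint l 0 (φ := φ) hθ
  simp only [Nat.cast_zero] at h0
  simp only [realExpansion, angularExpansion]
  refine Finset.sum_congr rfl fun l _ ↦ ?_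
  rw [h0]
  congr 2
  · simp
  · refine Finset.sum_congr rfl fun m _ ↦ ?_
    rw [sphHarm_sphPoint l m hθ, Complex.re_ofReal_mul, Complex.im_ofReal_mul,
      Complex.exp_ofReal_mul_I_re, Complex.exp_ofReal_mul_I_im]
    ring

end AdditionTheorem

/-! ### Measurable limits of random fields -/

section CauchyFields

variable {Ω Y : Type*} [MeasurableSpace Ω] [MeasurableSpace Y] {P : Measure Ω}

/-- A sequence of measurable random fields that is Cauchy in `L²`, uniformly over the points, has a
measurable limit. -/
theorem exists_measurable_field {S : ℕ → Y → Ω → ℝ}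
    (hS : ∀ N, Measurable fun q : Ω × Y ↦ S N q.2 q.1) {r : ℕ → ℝ≥0∞}
    (hr : Tendsto r atTop (𝓝 0))
    (h : ∀ N M y, N ≤ M → eLpNorm (S M y - S N y) 2 P ≤ r N) :
    ∃ Z : Y → Ω → ℝ, (Measurable fun q : Ω × Y ↦ Z q.2 q.1) ∧
      ∀ N y, eLpNorm (S N y - Z y) 2 P ≤ r N := by
  have hSy : ∀ N y, Measurable (S N y) := fun N y ↦ (hS N).comp (measurable_id.prodMk measurable_const)
  -- The rate does not depend on the point, so one rapidly convergent subsequence serves all points.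
  -- Its `limsup` is jointly measurable and equals the almost sure limit at each point.
  obtain ⟨φ, hφ, hφr⟩ := extraction_forall_of_eventually
    (P := fun n k ↦ r k < (2⁻¹ : ℝ≥0∞) ^ n) fun n ↦ hr.eventually_lt_const (ENNReal.pow_pos (by simp) n)
  refine ⟨fun y ω ↦ limsup (fun k ↦ S (φ k) y ω) atTop, Measurable.limsup fun k ↦ hS (φ k), ?_⟩
  intro N y
  have hcau : ∀ K n m : ℕ, K ≤ n → K ≤ m →
      eLpNorm (S (φ n) y - S (φ m) y) 2 P < (2⁻¹ : ℝ≥0∞) ^ K := by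
    intro K n m hn hm
    wlog hmn : m ≤ n generalizing n m
    · rw [eLpNorm_sub_comm]
      exact this m n hm hn (by omega)
    refine (h _ _ y (hφ.monotone hmn)).trans_lt ((hφr m).trans_le ?_)
    exact pow_le_pow_of_le_one (by simp) (by simp) hm
  have hae := Lp.ae_tendsto_of_cauchy_eLpNorm (μ := P) (p := 2) (f := fun k ↦ S (φ k) y)
    (fun n ↦ (hSy _ y).aestronglyMeasurable) (by norm_num)
    (B := fun n ↦ (2⁻¹ : ℝ≥0∞) ^ n) (by simp [ENNReal.tsum_geometric]) hcau
  have hlim : ∀ᵐ ω ∂P, Tendsto (fun k ↦ (S N y - S (φ k) y) ω) atTop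
      (𝓝 ((S N y - fun ω ↦ limsup (fun k ↦ S (φ k) y ω) atTop) ω)) := by
    filter_upwards [hae] with ω ⟨l, hl⟩
    simp only [Pi.sub_apply, hl.limsup_eq]
    exact tendsto_const_nhds.sub hl
  -- Fatou's lemma along the subsequence preserves the Cauchy bound in the limit.
  refine (Lp.eLpNorm_lim_le_liminf_eLpNorm
    (fun k ↦ ((hSy N y).sub (hSy _ y)).aestronglyMeasurable) _ hlim).trans ?_
  refine liminf_le_of_frequently_le' (Eventually.frequently ?_)
  filter_upwards [eventually_ge_atTop N] with k hk
  rw [eLpNorm_sub_comm]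
  exact h N _ y (hk.trans (hφ.id_le k))

/-- Tonelli: the bound at each point is integrated over `σ`. For a measure of finite mass, uniform
convergence in `L²(Ω)` thus gives convergence in `L²` of the product. -/
theorem eLpNorm_prod_le {σ : Measure Y} [SFinite P] [SFinite σ] {F : Y → Ω → ℝ}
    (hF : AEStronglyMeasurable (fun q : Ω × Y ↦ F q.2 q.1) (P.prod σ)) {c : ℝ≥0∞}
    (h : ∀ y, eLpNorm (F y) 2 P ≤ c) :
    eLpNorm (fun q : Ω × Y ↦ F q.2 q.1) 2 (P.prod σ) ≤ c * σ Set.univ ^ (1 / 2 : ℝ) := by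
  have h2 : ∀ y, ∫⁻ ω, ‖F y ω‖ₑ ^ (2 : ℝ) ∂P ≤ c ^ (2 : ℝ) := fun y ↦ by
    have := ENNReal.rpow_le_rpow (h y) (z := 2) (by norm_num)
    rw [eLpNorm_eq_lintegral_rpow_enorm_toReal (by norm_num) (by norm_num), ← ENNReal.rpow_mul]
      at this
    simpa using this
  rw [eLpNorm_eq_lintegral_rpow_enorm_toReal (by norm_num) (by norm_num)]
  rw [lintegral_prod_symm _ (hF.enorm.pow_const _)]
  calc _ ≤ (c ^ (2 : ℝ) * σ Set.univ) ^ (1 / 2 : ℝ) := by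
        simp only [ENNReal.toReal_ofNat]
        refine ENNReal.rpow_le_rpow ?_ (by norm_num)
        rw [← lintegral_const]
        exact lintegral_mono h2
    _ = _ := by
        rw [ENNReal.mul_rpow_of_nonneg _ _ (by norm_num), ← ENNReal.rpow_mul]
        norm_num

end CauchyFields

/-! ### Real modes of the expansion -/

section Modes

/-- The real modes of degree at most `N`. -/
def modeSet (N : ℕ) : Finset ModeIndex :=
  (Finset.univ ×ˢ (Finset.range (N + 1) ×ˢ Finset.range (N + 1))).subtype
    fun p ↦ p.2.2 ≤ p.2.1 ∧ (p.1 = 1 → 1 ≤ p.2.2)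

theorem modeSet_mono : Monotone modeSet := by
  intro N M h p hp
  have hp' := Finset.mem_subtype.1 hp
  refine Finset.mem_subtype.2 ?_
  simp only [Finset.mem_product, Finset.mem_univ, Finset.mem_range] at hp' ⊢
  have h' : N + 1 ≤ M + 1 := Nat.succ_le_succ h
  exact ⟨trivial, hp'.2.1.trans_le h', hp'.2.2.trans_le h'⟩

theorem sum_modeSet {R : Type*} [AddCommMonoid R] (f : Fin 2 → ℕ → ℕ → R) (N : ℕ) :
    ∑ p ∈ modeSet N, f p.1.1 p.1.2.1 p.1.2.2 =
      ∑ l ∈ Finset.range (N + 1), (f 0 l 0 + ∑ m ∈ Finset.Icc 1 l, (f 0 l m + f 1 l m)) := by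
  rw [modeSet, Finset.sum_subtype_eq_sum_filter (fun p : Fin 2 × ℕ × ℕ ↦ f p.1 p.2.1 p.2.2),
    Finset.sum_filter, Finset.sum_product, Fin.sum_univ_two, Finset.sum_product, Finset.sum_product,
    ← Finset.sum_add_distrib]
  refine Finset.sum_congr rfl fun l hl ↦ ?_
  rw [Finset.sum_add_distrib, ← Finset.sum_filter, ← Finset.sum_filter, ← add_assoc]
  have hl' := Finset.mem_range.1 hl
  congr 1
  · have : (Finset.range (N + 1)).filter (fun m ↦ m ≤ l ∧ ((0 : Fin 2) = 1 → 1 ≤ m)) =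
        insert 0 (Finset.Icc 1 l) := by
      ext m
      simp only [Finset.mem_filter, Finset.mem_range, Finset.mem_insert, Finset.mem_Icc,
        zero_ne_one, false_imp_iff]
      grind
    rw [this, Finset.sum_insert (by simp)]
  · refine Finset.sum_congr ?_ fun _ _ ↦ rfl
    ext m
    simp only [Finset.mem_filter, Finset.mem_range, Finset.mem_Icc]
    grind

/-- The real function on the sphere that multiplies the weight `b i l m` in `realExpansion`. -/
noncomputable def modeCoef (A : ℕ → ℝ) (y : S2) (i : Fin 2) (l m : ℕ) : ℝ :=
  if m = 0 then Real.sqrt (A l) * (sphHarm l 0 y).re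
  else Real.sqrt (2 * A l) * if i = 0 then (sphHarm l m y).re else (sphHarm l m y).im

theorem realExpansion_eq_sum (A : ℕ → ℝ) (b : Fin 2 → ℕ → ℕ → ℝ) (N : ℕ) (y : S2) :
    realExpansion A b N y = ∑ p ∈ modeSet N,
      modeCoef A y p.1.1 p.1.2.1 p.1.2.2 * b p.1.1 p.1.2.1 p.1.2.2 := by
  rw [sum_modeSet fun i l m ↦ modeCoef A y i l m * b i l m, realExpansion]
  refine Finset.sum_congr rfl fun l _ ↦ ?_
  rw [Finset.mul_sum]
  congr 1
  · simp [modeCoef]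
    ring
  · refine Finset.sum_congr rfl fun m hm ↦ ?_
    have : m ≠ 0 := by
      have := (Finset.mem_Icc.1 hm).1
      omega
    simp only [modeCoef, if_neg this, if_true, if_neg (one_ne_zero : (1 : Fin 2) ≠ 0)]
    ring

/-- The factors `√A_l` and `√(2 A_l)` square to the weights 1 and 2 of the addition theorem, times
`A_l`. -/
theorem sum_sq_modeCoef {A : ℕ → ℝ} (hA : ∀ l, 0 ≤ A l) (f : ℕ → ℝ) (N : ℕ) (y : S2) :
    ∑ p ∈ modeSet N, modeCoef A y p.1.1 p.1.2.1 p.1.2.2 ^ 2 * f p.1.2.1 =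
      ∑ l ∈ Finset.range (N + 1), (2 * l + 1) * A l * (f l / (4 * Real.pi)) := by
  rw [sum_modeSet fun i l m ↦ modeCoef A y i l m ^ 2 * f l]
  refine Finset.sum_congr rfl fun l _ ↦ ?_
  have h : (2 * (l : ℝ) + 1) * A l * (f l / (4 * Real.pi)) =
      A l * f l * ((2 * l + 1) / (4 * Real.pi)) := by ring
  rw [h, ← sum_sq_sphHarm l y, mul_add]
  congr 1
  · simp only [modeCoef, if_true, mul_pow, Real.sq_sqrt (hA l)]
    ring
  · rw [Finset.mul_sum, Finset.mul_sum]
    refine Finset.sum_congr rfl fun m hm ↦ ?_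
    have : m ≠ 0 := by
      have := (Finset.mem_Icc.1 hm).1
      omega
    have h2 : 0 ≤ 2 * A l := by linarith [hA l]
    simp only [modeCoef, if_neg this, if_true, if_neg (one_ne_zero : (1 : Fin 2) ≠ 0), mul_pow,
      Real.sq_sqrt h2]
    ring

theorem measurable_modeCoef (A : ℕ → ℝ) (i : Fin 2) (l m : ℕ) :
    Measurable fun y ↦ modeCoef A y i l m := by
  have h0 := measurable_sphHarm_natCast l 0
  have h := measurable_sphHarm_natCast l m
  simp only [Nat.cast_zero] at h0
  unfold modeCoef
  split_ifs
  · exact (Complex.measurable_re.comp h0).const_mul _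
  · exact (Complex.measurable_re.comp h).const_mul _
  · exact (Complex.measurable_im.comp h).const_mul _

end Modes

/-! ### Expansions with jointly Gaussian weights -/

section GaussianWeights

variable {Ω Ω' : Type*} [MeasurableSpace Ω] [MeasurableSpace Ω']
  {P : Measure Ω} {P' : Measure Ω'}

/-- The random weight `b i l m` of component `j`, for `q = ((i, l, m), j)`. -/
def weightVar (b : Ω → Fin 2 → Fin 2 → ℕ → ℕ → ℝ) (q : ModeIndex × Fin 2) (ω : Ω) : ℝ :=
  b ω q.2 q.1.1.1 q.1.1.2.1 q.1.1.2.2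

/-- The pairs `(b · 0 i l m, b · 1 i l m)` are jointly Gaussian, centered, uncorrelated for different
modes and have covariance matrix `C l`. -/
structure IsGaussianWeights (C : ℕ → Matrix (Fin 2) (Fin 2) ℝ)
    (b : Ω → Fin 2 → Fin 2 → ℕ → ℕ → ℝ) (P : Measure Ω) : Prop where
  gaussian : IsGaussianProcess (weightVar b) P
  mean : ∀ q, ∫ ω, weightVar b q ω ∂P = 0
  cov : ∀ p j q k, ∫ ω, weightVar b (p, j) ω * weightVar b (q, k) ω ∂P =
    if p = q then C p.1.2.1 j k else 0

variable {C : ℕ → Matrix (Fin 2) (Fin 2) ℝ} {b : Ω → Fin 2 → Fin 2 → ℕ → ℕ → ℝ}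
  {b' : Ω' → Fin 2 → Fin 2 → ℕ → ℕ → ℝ} {A : ℕ → ℝ}

namespace IsGaussianWeights

theorem memLp (h : IsGaussianWeights C b P) (q : ModeIndex × Fin 2) :
    MemLp (weightVar b q) 2 P :=
  (h.gaussian.hasGaussianLaw_eval q).memLp_two

/-- The classes of the weights. -/
noncomputable def weightLp (h : IsGaussianWeights C b P) : ModeIndex × Fin 2 → Lp ℝ 2 P :=
  processLp h.memLp

/-- The closed subspace of `L²(P)` generated by the weights. -/
noncomputable def space (h : IsGaussianWeights C b P) : Submodule ℝ (Lp ℝ 2 P) :=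
  (Submodule.span ℝ (Set.range h.weightLp)).topologicalClosure

theorem space_subset (h : IsGaussianWeights C b P) :
    (h.space : Set (Lp ℝ 2 P)) ⊆ centeredGaussians P :=
  have := h.gaussian.isProbabilityMeasure
  span_processLp_subset h.gaussian h.mean h.memLp

theorem weightLp_mem (h : IsGaussianWeights C b P) (q : ModeIndex × Fin 2) :
    h.weightLp q ∈ h.space :=
  Submodule.le_topologicalClosure _ (Submodule.subset_span ⟨q, rfl⟩)

theorem inner_weightLp (h : IsGaussianWeights C b P) (p : ModeIndex) (j : Fin 2) (q : ModeIndex)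
    (k : Fin 2) : inner ℝ (h.weightLp (p, j)) (h.weightLp (q, k)) =
      if p = q then C p.1.2.1 j k else 0 := by
  rw [weightLp, processLp, processLp, inner_toLp, h.cov]

/-- The combinations of the weights of one component over a finite set of modes. -/
noncomputable def combination (h : IsGaussianWeights C b P) (s : Finset ModeIndex)
    (c : ModeIndex → ℝ) (j : Fin 2) : Lp ℝ 2 P :=
  ∑ p ∈ s, c p • h.weightLp (p, j)

theorem combination_mem (h : IsGaussianWeights C b P) (s : Finset ModeIndex)
    (c : ModeIndex → ℝ) (j : Fin 2) : h.combination s c j ∈ h.space :=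
  h.space.sum_mem fun _ _ ↦ h.space.smul_mem _ (h.weightLp_mem _)

theorem inner_combination (h : IsGaussianWeights C b P) (s : Finset ModeIndex)
    (c d : ModeIndex → ℝ) (j k : Fin 2) :
    inner ℝ (h.combination s c j) (h.combination s d k) =
      ∑ p ∈ s, c p * d p * C p.1.2.1 j k := by
  simp only [combination, sum_inner, inner_sum, real_inner_smul_left, real_inner_smul_right,
    inner_weightLp]
  refine Finset.sum_congr rfl fun p hp ↦ ?_
  rw [Finset.sum_eq_single p]
  · rw [if_pos rfl]
    ring
  · intro q _ hq
    rw [if_neg hq]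
    ring
  · exact fun h ↦ (h hp).elim

theorem coeFn_combination (h : IsGaussianWeights C b P) (s : Finset ModeIndex)
    (c : ModeIndex → ℝ) (j : Fin 2) :
    (fun ω ↦ ∑ p ∈ s, c p * weightVar b (p, j) ω) =ᵐ[P] h.combination s c j := by
  refine EventuallyEq.trans ?_ (Lp.coeFn_finsetSum _ _).symm
  have h1 : ∀ᵐ ω ∂P, ∀ p ∈ s, (c p • h.weightLp (p, j) : Lp ℝ 2 P) ω =
      c p * weightVar b (p, j) ω := by
    refine (ae_ball_iff s.countable_toSet).2 fun p _ ↦ ?_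
    filter_upwards [Lp.coeFn_smul (c p) (h.weightLp (p, j)), (h.memLp (p, j)).coeFn_toLp]
      with ω h1 h2
    rw [h1, Pi.smul_apply, weightLp, processLp, h2, smul_eq_mul]
  filter_upwards [h1] with ω h
  rw [Finset.sum_apply]
  exact (Finset.sum_congr rfl h).symm

/-- The classes of the partial sums of the field. -/
noncomputable def expansionLp (h : IsGaussianWeights C b P) (A : ℕ → ℝ) (N : ℕ)
    (q : Fin 2 × S2) : Lp ℝ 2 P :=
  h.combination (modeSet N) (fun p ↦ modeCoef A q.2 p.1.1 p.1.2.1 p.1.2.2) q.1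

theorem coeFn_expansionLp (h : IsGaussianWeights C b P) (N : ℕ) (q : Fin 2 × S2) :
    (fun ω ↦ realExpansion A (b ω q.1) N q.2) =ᵐ[P] h.expansionLp A N q := by
  simp_rw [realExpansion_eq_sum]
  exact h.coeFn_combination _ _ _

theorem memLp_realExpansion (h : IsGaussianWeights C b P) (N : ℕ) (q : Fin 2 × S2) :
    MemLp (fun ω ↦ realExpansion A (b ω q.1) N q.2) 2 P :=
  (memLp_congr_ae (h.coeFn_expansionLp N q)).2 (Lp.memLp _)

theorem toLp_realExpansion (h : IsGaussianWeights C b P) (N : ℕ) (q : Fin 2 × S2) :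
    (h.memLp_realExpansion (A := A) N q).toLp _ = h.expansionLp A N q := by
  ext1
  exact (MemLp.coeFn_toLp _).trans (h.coeFn_expansionLp N q)

/-- The modes of degree in `(N, M]` are orthogonal and have variance at most `K`; the addition
theorem then sums their squared coefficients, leaving a piece of the trace series. -/
theorem norm_expansionLp_sub_sq_le (h : IsGaussianWeights C b P) (hA : ∀ l, 0 ≤ A l)
    (hA' : Summable fun l : ℕ ↦ (2 * (l : ℝ) + 1) * A l) {K : ℝ} (hC : ∀ l j, C l j j ≤ K)
    {N M : ℕ} (hNM : N ≤ M) (q : Fin 2 × S2) :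
    ‖h.expansionLp A M q - h.expansionLp A N q‖ ^ 2 ≤
      K / (4 * Real.pi) * (∑' l : ℕ, (2 * (l : ℝ) + 1) * A l -
        ∑ l ∈ Finset.range (N + 1), (2 * (l : ℝ) + 1) * A l) := by
  have e : h.expansionLp A M q - h.expansionLp A N q = h.combination (modeSet M \ modeSet N)
      (fun p ↦ modeCoef A q.2 p.1.1 p.1.2.1 p.1.2.2) q.1 := by
    rw [sub_eq_iff_eq_add]
    exact (Finset.sum_sdiff (modeSet_mono hNM)).symm
  rw [e, ← real_inner_self_eq_norm_sq, inner_combination]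
  have hp : ∀ l : ℕ, 0 ≤ (2 * (l : ℝ) + 1) * A l := fun l ↦ mul_nonneg (by positivity) (hA l)
  calc _ ≤ ∑ p ∈ modeSet M \ modeSet N, modeCoef A q.2 p.1.1 p.1.2.1 p.1.2.2 ^ 2 * K := by
        refine Finset.sum_le_sum fun p _ ↦ ?_
        rw [← sq]
        exact mul_le_mul_of_nonneg_left (hC _ _) (sq_nonneg _)
    _ = ∑ l ∈ Finset.range (M + 1), (2 * (l : ℝ) + 1) * A l * (K / (4 * Real.pi)) -
        ∑ l ∈ Finset.range (N + 1), (2 * (l : ℝ) + 1) * A l * (K / (4 * Real.pi)) := by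
        rw [← sum_sq_modeCoef hA (fun _ ↦ K) M q.2, ← sum_sq_modeCoef hA (fun _ ↦ K) N q.2,
          Finset.sum_sdiff_eq_sub (modeSet_mono hNM)]
    _ ≤ _ := by
        have hK : 0 ≤ K / (4 * Real.pi) := by
          -- This entry is the squared norm of a weight, so `K ≥ 0` is automatic.
          have h0 : 0 ≤ C 0 0 0 := by
            have := h.inner_weightLp ⟨(0, 0, 0), by simp⟩ 0 ⟨(0, 0, 0), by simp⟩ 0
            rw [if_pos rfl] at this
            rw [← this]
            exact real_inner_self_nonneg
          have := h0.trans (hC 0 0)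
          positivity
        rw [← Finset.sum_mul, ← Finset.sum_mul, ← sub_mul, mul_comm]
        gcongr
        exact hA'.sum_le_tsum _ fun l _ ↦ hp l

/-- The sum of the expansion with Gaussian weights exists as a random field. -/
theorem exists_isFieldSum (h : IsGaussianWeights C b P) (hA : ∀ l, 0 ≤ A l)
    (hA' : Summable fun l : ℕ ↦ (2 * (l : ℝ) + 1) * A l) {K : ℝ} (hC : ∀ l j, C l j j ≤ K) :
    ∃ Z, IsFieldSum (fun N j y ω ↦ realExpansion A (b ω j) N y) Z P := by
  have := h.gaussian.isProbabilityMeasure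
  have hfin : IsFiniteMeasure surfaceMeasure := by
    unfold surfaceMeasure
    infer_instance
  have hm := fun q ↦ h.gaussian.aemeasurable q
  -- The weights are only almost everywhere measurable, while the field has to be jointly
  -- measurable. There are countably many of them, so measurable versions agree with them off one
  -- null set.
  set w : ModeIndex × Fin 2 → Ω → ℝ := fun q ↦ (hm q).mk _ with hw
  have hwae : ∀ᵐ ω ∂P, ∀ q, weightVar b q ω = w q ω := ae_all_iff.2 fun q ↦ (hm q).ae_eq_mk
  set S : Fin 2 → ℕ → S2 → Ω → ℝ := fun j N y ω ↦
    ∑ p ∈ modeSet N, modeCoef A y p.1.1 p.1.2.1 p.1.2.2 * w (p, j) ω with hS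
  have hSm : ∀ j N, Measurable fun q : Ω × S2 ↦ S j N q.2 q.1 := fun j N ↦ by
    refine Finset.measurable_sum _ fun p _ ↦ ?_
    exact ((measurable_modeCoef A _ _ _).comp measurable_snd).mul
      ((hm (p, j)).measurable_mk.comp measurable_fst)
  -- The null set does not depend on `y`, hence it stays null when pulled back to `Ω × S2`.
  have hSae : ∀ᵐ ω ∂P, ∀ N j y, realExpansion A (b ω j) N y = S j N y ω := by
    filter_upwards [hwae] with ω hω N j y
    rw [realExpansion_eq_sum]
    refine Finset.sum_congr rfl fun p _ ↦ ?_
    rw [← hω]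
    rfl
  set ρ : ℕ → ℝ := fun N ↦ K / (4 * Real.pi) * (∑' l : ℕ, (2 * (l : ℝ) + 1) * A l -
        ∑ l ∈ Finset.range (N + 1), (2 * (l : ℝ) + 1) * A l) with hρ
  set r : ℕ → ℝ≥0∞ := fun N ↦ ENNReal.ofReal (Real.sqrt (ρ N)) with hr
  have hρ0 : Tendsto ρ atTop (𝓝 0) := by
    have h1 := (hA'.hasSum.tendsto_sum_nat.comp (tendsto_add_atTop_nat 1)).const_sub
      (∑' l : ℕ, (2 * (l : ℝ) + 1) * A l)
    have h2 := h1.const_mul (K / (4 * Real.pi))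
    simpa using h2
  have hr0 : Tendsto r atTop (𝓝 0) := by
    have := ENNReal.tendsto_ofReal ((Real.continuous_sqrt.tendsto 0).comp hρ0)
    simpa using this
  have hcau : ∀ j N M y, N ≤ M → eLpNorm (S j M y - S j N y) 2 P ≤ r N := by
    intro j N M y hNM
    have e : S j M y - S j N y =ᵐ[P] ⇑(h.expansionLp A M (j, y) - h.expansionLp A N (j, y)) := by
      filter_upwards [hSae, Lp.coeFn_sub (h.expansionLp A M (j, y)) (h.expansionLp A N (j, y)),
        h.coeFn_expansionLp (A := A) M (j, y), h.coeFn_expansionLp (A := A) N (j, y)]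
        with ω h1 h2 h3 h4
      rw [h2, Pi.sub_apply, Pi.sub_apply, ← h1, ← h1, ← h3, ← h4]
    rw [eLpNorm_congr_ae e, ← Lp.enorm_def, ← ofReal_norm]
    refine ENNReal.ofReal_le_ofReal (Real.le_sqrt_of_sq_le ?_)
    exact h.norm_expansionLp_sub_sq_le hA hA' hC hNM (j, y)
  choose Z hZm hZ using fun j ↦ exists_measurable_field (hSm j) hr0 (hcau j)
  have hlim0 := hr0
  refine ⟨Z, hZm, fun j y ↦ ?_, fun j ↦ ?_⟩
  · refine tendsto_of_tendsto_of_tendsto_of_le_of_le tendsto_const_nhds hr0 (fun _ ↦ zero_le)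
      fun N ↦ ?_
    refine le_trans (le_of_eq (eLpNorm_congr_ae ?_)) (hZ j N y)
    filter_upwards [hSae] with ω hω
    simp [hω]
  · have hlim := ENNReal.Tendsto.mul_const (b := surfaceMeasure Set.univ ^ (1 / 2 : ℝ)) hr0
      (Or.inr (ENNReal.rpow_ne_top_of_nonneg (by norm_num) (measure_ne_top _ _)))
    rw [zero_mul] at hlim
    refine tendsto_of_tendsto_of_tendsto_of_le_of_le tendsto_const_nhds hlim (fun _ ↦ zero_le)
      fun N ↦ ?_
    refine le_trans (le_of_eq (eLpNorm_congr_ae ?_)) (eLpNorm_prod_le (P := P)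
      (σ := surfaceMeasure) (F := fun y ↦ S j N y - Z j y)
      ((hSm j N).sub (hZm j)).aestronglyMeasurable (hZ j N))
    filter_upwards [Measure.quasiMeasurePreserving_fst.ae hSae] with q hq
    simp [hq]

/-- The field is at finite `L²` distance from some partial sum, which is square integrable. -/
theorem memLp_of_isFieldSum (h : IsGaussianWeights C b P) {Z : Fin 2 → S2 → Ω → ℝ}
    (hZ : IsFieldSum (fun N j y ω ↦ realExpansion A (b ω j) N y) Z P) (q : Fin 2 × S2) :
    MemLp (Z q.1 q.2) 2 P := by
  have hm : Measurable (Z q.1 q.2) :=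
    (hZ.measurable q.1).comp (measurable_id.prodMk measurable_const)
  obtain ⟨N, hN⟩ := ((hZ.tendsto_eval q.1 q.2).eventually_lt_const ENNReal.zero_lt_top).exists
  simp only [RCLike.ofReal_real_eq_id, id] at hN
  have h1 := h.memLp_realExpansion (A := A) N q
  have h2 : MemLp (fun ω ↦ realExpansion A (b ω q.1) N q.2 - Z q.1 q.2 ω) 2 P :=
    ⟨h1.1.sub hm.aestronglyMeasurable, hN⟩
  have := h1.sub h2
  convert this using 1
  ext ω
  simp

theorem tendsto_expansionLp (h : IsGaussianWeights C b P) {Z : Fin 2 → S2 → Ω → ℝ}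
    (hZ : IsFieldSum (fun N j y ω ↦ realExpansion A (b ω j) N y) Z P) (q : Fin 2 × S2) :
    Tendsto (fun N ↦ h.expansionLp A N q) atTop (𝓝 ((h.memLp_of_isFieldSum hZ q).toLp _)) := by
  simp_rw [← h.toLp_realExpansion]
  rw [Lp.tendsto_Lp_iff_tendsto_eLpNorm'']
  have := hZ.tendsto_eval q.1 q.2
  simp only [RCLike.ofReal_real_eq_id, id] at this
  exact this

theorem toLp_mem_space (h : IsGaussianWeights C b P) {Z : Fin 2 → S2 → Ω → ℝ}
    (hZ : IsFieldSum (fun N j y ω ↦ realExpansion A (b ω j) N y) Z P) (q : Fin 2 × S2) :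
    (h.memLp_of_isFieldSum hZ q).toLp _ ∈ h.space :=
  (Submodule.isClosed_topologicalClosure _).mem_of_tendsto (h.tendsto_expansionLp hZ q)
    (Eventually.of_forall fun _ ↦ h.combination_mem _ _ _)

theorem isGaussianProcess_of_isFieldSum (h : IsGaussianWeights C b P) {Z : Fin 2 → S2 → Ω → ℝ}
    (hZ : IsFieldSum (fun N j y ω ↦ realExpansion A (b ω j) N y) Z P) :
    IsGaussianProcess (fun q : Fin 2 × S2 ↦ Z q.1 q.2) P :=
  have := h.gaussian.isProbabilityMeasure
  isGaussianProcess_of_mem_centeredGaussians h.space_subset (fun q ↦ h.toLp_mem_space hZ q)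
    fun q ↦ (h.memLp_of_isFieldSum hZ q).coeFn_toLp.symm

theorem integral_eq_zero_of_isFieldSum (h : IsGaussianWeights C b P) {Z : Fin 2 → S2 → Ω → ℝ}
    (hZ : IsFieldSum (fun N j y ω ↦ realExpansion A (b ω j) N y) Z P) (j : Fin 2) (y : S2) :
    ∫ ω, Z j y ω ∂P = 0 := by
  have := h.gaussian.isProbabilityMeasure
  rw [← integral_eq_zero_of_mem_centeredGaussians (h.space_subset (h.toLp_mem_space hZ (j, y)))]
  exact integral_congr_ae (h.memLp_of_isFieldSum hZ (j, y)).coeFn_toLp.symm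

/-- Both fields lie in Gaussian subspaces, and their covariances are limits of the same finite sums,
which involve only `C` and the mode functions. -/
theorem identDistrib_field (h : IsGaussianWeights C b P) (h' : IsGaussianWeights C b' P')
    {Z : Fin 2 → S2 → Ω → ℝ} {Z' : Fin 2 → S2 → Ω' → ℝ}
    (hZ : IsFieldSum (fun N j y ω ↦ realExpansion A (b ω j) N y) Z P)
    (hZ' : IsFieldSum (fun N j y ω ↦ realExpansion A (b' ω j) N y) Z' P') :
    IdentDistrib (fun ω (q : Fin 2 × S2) ↦ Z q.1 q.2 ω)
      (fun ω (q : Fin 2 × S2) ↦ Z' q.1 q.2 ω) P P' := by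
  have := h.gaussian.isProbabilityMeasure
  have := h'.gaussian.isProbabilityMeasure
  refine identDistrib_of_inner_eq h.space_subset (fun q ↦ h.toLp_mem_space hZ q)
    h'.space_subset (fun q ↦ h'.toLp_mem_space hZ' q) (fun q q' ↦ ?_)
    (fun q ↦ (h.memLp_of_isFieldSum hZ q).coeFn_toLp.symm)
    (fun q ↦ (h'.memLp_of_isFieldSum hZ' q).coeFn_toLp.symm)
    (measurable_pi_lambda _ fun q : Fin 2 × S2 ↦
      (hZ.measurable q.1).comp (measurable_id.prodMk measurable_const)).aemeasurable
    (measurable_pi_lambda _ fun q : Fin 2 × S2 ↦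
      (hZ'.measurable q.1).comp (measurable_id.prodMk measurable_const)).aemeasurable
  have t := (h.tendsto_expansionLp hZ q).inner (𝕜 := ℝ) (h.tendsto_expansionLp hZ q')
  have t' := (h'.tendsto_expansionLp hZ' q).inner (𝕜 := ℝ) (h'.tendsto_expansionLp hZ' q')
  simp only [expansionLp, inner_combination] at t t'
  exact tendsto_nhds_unique t t'

theorem identDistrib_weights (h : IsGaussianWeights C b P) (h' : IsGaussianWeights C b' P') :
    IdentDistrib (fun ω q ↦ weightVar b q ω) (fun ω q ↦ weightVar b' q ω) P P' := by
  have := h.gaussian.isProbabilityMeasure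
  have := h'.gaussian.isProbabilityMeasure
  refine identDistrib_of_inner_eq h.space_subset h.weightLp_mem h'.space_subset h'.weightLp_mem
    (fun q q' ↦ ?_) (fun q ↦ (h.memLp q).coeFn_toLp.symm) (fun q ↦ (h'.memLp q).coeFn_toLp.symm)
    (aemeasurable_pi_lambda _ h.gaussian.aemeasurable)
    (aemeasurable_pi_lambda _ h'.gaussian.aemeasurable)
  rw [← Prod.mk.eta (p := q), ← Prod.mk.eta (p := q'), h.inner_weightLp, h'.inner_weightLp]

end IsGaussianWeights

/-- Extension by zero of a family of weights on the modes. -/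
noncomputable def extendWeights (x : ModeIndex × Fin 2 → ℝ) (j i : Fin 2) (l m : ℕ) : ℝ :=
  if h : m ≤ l ∧ (i = 1 → 1 ≤ m) then x (⟨(i, l, m), h⟩, j) else 0

theorem fieldCoeff_congr {c c' : Fin 2 → ℕ → ℕ → ℝ} (A : ℕ → ℝ)
    (h : ∀ p : ModeIndex, c p.1.1 p.1.2.1 p.1.2.2 = c' p.1.1 p.1.2.1 p.1.2.2) {l : ℕ} {m : ℤ}
    (hm : |m| ≤ l) : fieldCoeff A c l m = fieldCoeff A c' l m := by
  have hml : m.natAbs ≤ l := by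
    have := abs_le.1 hm
    omega
  have e0 := h ⟨(0, l, m.natAbs), by simp [hml]⟩
  simp only at e0
  by_cases hm0 : m = 0
  · subst hm0
    simp only [Int.natAbs_zero] at e0
    simp [fieldCoeff, e0]
  · have e1 := h ⟨(1, l, m.natAbs), hml, fun _ ↦ by simp only; omega⟩
    simp only at e1
    simp only [fieldCoeff, if_neg hm0, e0, e1]

theorem measurable_fieldCoeff_extendWeights (A : ℕ → ℝ) (l : ℕ) (m : ℤ) (j : Fin 2) :
    Measurable fun x ↦ fieldCoeff A (extendWeights x j) l m := by
  have h : ∀ i l m, Measurable fun x ↦ extendWeights x j i l m := fun i l m ↦ by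
    unfold extendWeights
    split_ifs
    · exact measurable_pi_apply _
    · exact measurable_const
  unfold fieldCoeff
  split_ifs <;> fun_prop

omit [MeasurableSpace Ω] in
theorem fieldCoeff_extendWeights (A : ℕ → ℝ) (b : Ω → Fin 2 → Fin 2 → ℕ → ℕ → ℝ) (ω : Ω)
    (j : Fin 2) {l : ℕ} {m : ℤ} (hm : |m| ≤ l) :
    fieldCoeff A (extendWeights (fun q ↦ weightVar b q ω) j) l m = fieldCoeff A (b ω j) l m :=
  fieldCoeff_congr A (fun p ↦ by simp [extendWeights, weightVar, p.2.1]; grind) hm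

/-- The coefficients with `|m| ≤ l` are one fixed measurable function of the weights on the modes;
extension by zero makes this function explicit. -/
theorem IsGaussianWeights.identDistrib_fieldCoeff (h : IsGaussianWeights C b P)
    (h' : IsGaussianWeights C b' P') (A : ℕ → ℝ) :
    IdentDistrib
      (fun ω (q : {p : ℕ × ℤ // |p.2| ≤ (p.1 : ℤ)} × Fin 2) ↦
        fieldCoeff A (b ω q.2) q.1.1.1 q.1.1.2)
      (fun ω (q : {p : ℕ × ℤ // |p.2| ≤ (p.1 : ℤ)} × Fin 2) ↦
        fieldCoeff A (b' ω q.2) q.1.1.1 q.1.1.2) P P' := by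
  have := (h.identDistrib_weights h').comp
    (u := fun x (q : {p : ℕ × ℤ // |p.2| ≤ (p.1 : ℤ)} × Fin 2) ↦
      fieldCoeff A (extendWeights x q.2) q.1.1.1 q.1.1.2)
    (measurable_pi_lambda _ fun q ↦ measurable_fieldCoeff_extendWeights A _ _ _)
  convert this using 1
  · ext ω q
    exact (fieldCoeff_extendWeights A b ω q.2 q.1.2).symm
  · ext ω q
    exact (fieldCoeff_extendWeights A b' ω q.2 q.1.2).symm

/-- Passes from the complex series that defines the convolution to the real series used in the
estimates. -/
theorem isFieldSum_ofReal_iff {S : ℕ → Fin 2 → S2 → Ω → ℂ} {S' : ℕ → Fin 2 → S2 → Ω → ℝ}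
    (h : ∀ᵐ ω ∂P, ∀ N j y, S N j y ω = S' N j y ω) {Z : Fin 2 → S2 → Ω → ℝ} [SFinite P] :
    IsFieldSum S Z P ↔ IsFieldSum S' Z P := by
  have e1 : ∀ N j y, eLpNorm (fun ω ↦ S N j y ω - ((Z j y ω : ℝ) : ℂ)) 2 P =
      eLpNorm (fun ω ↦ S' N j y ω - ((Z j y ω : ℝ) : ℝ)) 2 P := fun N j y ↦ by
    refine eLpNorm_congr_norm_ae ?_
    filter_upwards [h] with ω hω
    rw [hω, ← Complex.ofReal_sub, Complex.norm_real]
  have e2 : ∀ N j, eLpNorm (fun q : Ω × S2 ↦ S N j q.2 q.1 - ((Z j q.2 q.1 : ℝ) : ℂ)) 2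
      (P.prod surfaceMeasure) =
      eLpNorm (fun q : Ω × S2 ↦ S' N j q.2 q.1 - ((Z j q.2 q.1 : ℝ) : ℝ)) 2
      (P.prod surfaceMeasure) := fun N j ↦ by
    refine eLpNorm_congr_norm_ae ?_
    filter_upwards [Measure.quasiMeasurePreserving_fst.ae h] with q hq
    rw [hq, ← Complex.ofReal_sub, Complex.norm_real]
  constructor
  · intro hS
    have t1 := hS.tendsto_eval
    have t2 := hS.tendsto_L2
    simp only [RCLike.ofReal_eq_complex_ofReal, e1, e2] at t1 t2
    exact ⟨hS.measurable, t1, t2⟩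
  · intro hS
    refine ⟨hS.measurable, fun j y ↦ ?_, fun j ↦ ?_⟩
    · simp only [RCLike.ofReal_eq_complex_ofReal, e1]
      exact hS.tendsto_eval j y
    · simp only [RCLike.ofReal_eq_complex_ofReal, e2]
      exact hS.tendsto_L2 j

end GaussianWeights

/-! ### Extension of isometries to closures -/

section IsometricExtension

variable {M H H' : Type*} [AddCommGroup M] [Module ℝ M] [NormedAddCommGroup H]
  [InnerProductSpace ℝ H] [NormedAddCommGroup H'] [InnerProductSpace ℝ H']

/-- The partial isometry from `a c` to `b c` maps Cauchy sequences to Cauchy sequences. Recording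
the image through its distances to all `b c` gives the exact error of every approximation and avoids
a quotient by the kernel of `a`. -/
theorem exists_norm_sub_eq_of_mem_closure [CompleteSpace H] (a : M →ₗ[ℝ] H') (b : M →ₗ[ℝ] H)
    (hab : ∀ c, ‖b c‖ = ‖a c‖) {f : H'} (hf : f ∈ closure (Set.range a)) :
    ∃ x, ∀ c, ‖x - b c‖ = ‖f - a c‖ := by
  obtain ⟨u, hu, huf⟩ := mem_closure_iff_seq_limit.1 hf
  choose v hv using hu
  have hva : Tendsto (fun n ↦ a (v n)) atTop (𝓝 f) := by simpa [hv] using huf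
  have hc : CauchySeq fun n ↦ b (v n) := by
    have := hva.cauchySeq
    rw [Metric.cauchySeq_iff] at this ⊢
    simpa only [dist_eq_norm, ← map_sub, hab] using this
  obtain ⟨x, hx⟩ := cauchySeq_tendsto_of_complete hc
  refine ⟨x, fun c ↦ ?_⟩
  have h1 := (hx.sub_const (b c)).norm
  have h2 := (hva.sub_const (a c)).norm
  simp only [← map_sub, hab] at h1 h2
  exact tendsto_nhds_unique h1 h2

theorem tendsto_of_norm_sub_eq {a : M →ₗ[ℝ] H'} {b : M →ₗ[ℝ] H} {f : H'} {x : H}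
    (hx : ∀ c, ‖x - b c‖ = ‖f - a c‖) {ι : Type*} {F : Filter ι} {v : ι → M}
    (hv : Tendsto (fun n ↦ a (v n)) F (𝓝 f)) : Tendsto (fun n ↦ b (v n)) F (𝓝 x) := by
  rw [tendsto_iff_norm_sub_tendsto_zero] at hv ⊢
  simpa only [norm_sub_rev _ f, norm_sub_rev _ x, hx] using hv

/-- Continuity of the inner product along approximating sequences. The constant `κ` covers equal
modes (`1`) and different, orthogonal ones (`0`) at once. -/
theorem inner_eq_of_norm_sub_eq {a : M →ₗ[ℝ] H'} {b b' : M →ₗ[ℝ] H} {κ : ℝ}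
    (hb : ∀ c d, inner ℝ (b c) (b' d) = κ * inner ℝ (a c) (a d)) {f g : H'} {x y : H}
    (hf : f ∈ closure (Set.range a)) (hg : g ∈ closure (Set.range a))
    (hx : ∀ c, ‖x - b c‖ = ‖f - a c‖) (hy : ∀ c, ‖y - b' c‖ = ‖g - a c‖) :
    inner ℝ x y = κ * inner ℝ f g := by
  obtain ⟨u, hu, huf⟩ := mem_closure_iff_seq_limit.1 hf
  obtain ⟨w, hw, hwg⟩ := mem_closure_iff_seq_limit.1 hg
  choose v hv using hu
  choose v' hv' using hw
  obtain rfl : (fun n ↦ a (v n)) = u := funext hv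
  obtain rfl : (fun n ↦ a (v' n)) = w := funext hv'
  have t := (tendsto_of_norm_sub_eq hx huf).inner (𝕜 := ℝ) (tendsto_of_norm_sub_eq hy hwg)
  simp only [hb] at t
  exact tendsto_nhds_unique t ((huf.inner hwg).const_mul κ)

theorem inner_linearCombination_eq {ι : Type*} {W W' : ι → H} {e : ι → H'} {κ : ℝ}
    (h : ∀ i j, inner ℝ (W i) (W' j) = κ * inner ℝ (e i) (e j)) (c d : ι →₀ ℝ) :
    inner ℝ (Finsupp.linearCombination ℝ W c) (Finsupp.linearCombination ℝ W' d) =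
      κ * inner ℝ (Finsupp.linearCombination ℝ e c) (Finsupp.linearCombination ℝ e d) := by
  simp only [Finsupp.linearCombination_apply, Finsupp.sum, sum_inner, inner_sum,
    real_inner_smul_left, real_inner_smul_right, h, Finset.mul_sum]
  refine Finset.sum_congr rfl fun _ _ ↦ Finset.sum_congr rfl fun _ _ ↦ by ring

end IsometricExtension

/-! ### Step functions and Riemann sums on uniform grids -/

section StepFunctions

theorem indicator_Ioc_eq_sub {a b : ℝ} (hab : a ≤ b) (c s : ℝ) :
    Set.indicator (Set.Ioc a b) (fun _ ↦ c) s =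
      c * ((if s ≤ b then 1 else 0) - if s ≤ a then 1 else 0) := by
  simp only [Set.indicator, Set.mem_Ioc]
  split_ifs <;> first | linarith | (exfalso; grind)

theorem abs_sub_stepFun_le {n : ℕ} {τ : ℕ → ℝ≥0} (hτ : Monotone τ) {c : ℕ → ℝ} {f : ℝ → ℝ}
    {ε : ℝ} (h : ∀ k < n, ∀ s ∈ Set.Ioc (τ k : ℝ) (τ (k + 1)), |f s - c k| ≤ ε) {s : ℝ}
    (hs : s ∈ Set.Ioc (τ 0 : ℝ) (τ n)) : |f s - stepFun n τ c s| ≤ ε := by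
  -- A constant is its own step function on the partitioned interval, by telescoping. The error is
  -- then a step sum with values `f s - c k`, to be compared with the one for `ε`.
  have hsum : ∀ x : ℝ, ∑ k ∈ Finset.range n,
      Set.indicator (Set.Ioc (τ k : ℝ) (τ (k + 1) : ℝ)) (fun _ ↦ x) s = x := fun x ↦ by
    have : ∀ k ∈ Finset.range n, Set.indicator (Set.Ioc (τ k : ℝ) (τ (k + 1) : ℝ)) (fun _ ↦ x) s =
        x * (if s ≤ τ (k + 1) then 1 else 0) - x * (if s ≤ τ k then 1 else 0) := fun k _ ↦ by
      rw [indicator_Ioc_eq_sub (NNReal.coe_le_coe.2 (hτ k.le_succ)), mul_sub]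
    rw [Finset.sum_congr rfl this,
      Finset.sum_range_sub (fun k ↦ x * (if s ≤ (τ k : ℝ) then (1 : ℝ) else 0)), if_pos hs.2,
      if_neg (not_le.2 hs.1)]
    ring
  have e : f s - stepFun n τ c s = ∑ k ∈ Finset.range n,
      Set.indicator (Set.Ioc (τ k : ℝ) (τ (k + 1) : ℝ)) (fun _ ↦ f s - c k) s := by
    conv_lhs => rw [← hsum (f s)]
    rw [stepFun, ← Finset.sum_sub_distrib]
    refine Finset.sum_congr rfl fun k _ ↦ ?_
    simp only [Set.indicator]
    split_ifs <;> simp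
  rw [e, ← hsum ε]
  refine (Finset.abs_sum_le_sum_abs _ _).trans (Finset.sum_le_sum fun k hk ↦ ?_)
  simp only [Set.indicator]
  split_ifs with hsk
  · exact h k (Finset.mem_range.1 hk) s hsk
  · simp

/-- The points of the uniform partition of `[0,t]` into `n + 1` intervals. -/
noncomputable def gridPoint (t : ℝ≥0) (n k : ℕ) : ℝ≥0 := k * (t / (n + 1))

theorem gridPoint_mono (t : ℝ≥0) (n : ℕ) : Monotone (gridPoint t n) := fun k l h ↦ by
  unfold gridPoint
  gcongr

@[simp] theorem gridPoint_zero (t : ℝ≥0) (n : ℕ) : gridPoint t n 0 = 0 := by simp [gridPoint]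

@[simp] theorem gridPoint_last (t : ℝ≥0) (n : ℕ) : gridPoint t n (n + 1) = t := by
  unfold gridPoint
  push_cast
  field_simp

theorem gridPoint_le {t : ℝ≥0} {n k : ℕ} (hk : k ≤ n + 1) : gridPoint t n k ≤ t :=
  (gridPoint_mono t n hk).trans (gridPoint_last t n).le

/-- Uniform continuity on a compact interval. Right endpoints serve the integrands, left endpoints
the Riemann sums of the paths. -/
theorem eventually_abs_sub_gridPoint_le {t : ℝ≥0} {f : ℝ → ℝ}
    (hf : ContinuousOn f (Set.Icc 0 (t : ℝ))) {ε : ℝ} (hε : 0 < ε) :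
    ∀ᶠ n in atTop, ∀ k < n + 1, ∀ s ∈ Set.Ioc (gridPoint t n k : ℝ) (gridPoint t n (k + 1)),
      |f s - f (gridPoint t n k)| ≤ ε ∧ |f s - f (gridPoint t n (k + 1))| ≤ ε := by
  have hu := isCompact_Icc.uniformContinuousOn_of_continuous hf
  rw [Metric.uniformContinuousOn_iff] at hu
  obtain ⟨δ, hδ, h⟩ := hu ε hε
  have hlim : Tendsto (fun n : ℕ ↦ (t : ℝ) * (1 / ((n : ℝ) + 1))) atTop (𝓝 0) := by
    simpa using tendsto_one_div_add_atTop_nhds_zero_nat.const_mul (t : ℝ)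
  filter_upwards [hlim.eventually_lt_const hδ] with n hn k hk s hs
  have hstep : (gridPoint t n (k + 1) : ℝ) = gridPoint t n k + t * (1 / ((n : ℝ) + 1)) := by
    simp only [gridPoint]
    push_cast
    ring
  have h1 : (gridPoint t n k : ℝ) ∈ Set.Icc 0 (t : ℝ) :=
    ⟨NNReal.coe_nonneg _, NNReal.coe_le_coe.2 (gridPoint_le hk.le)⟩
  have h2 : (gridPoint t n (k + 1) : ℝ) ∈ Set.Icc 0 (t : ℝ) :=
    ⟨NNReal.coe_nonneg _, NNReal.coe_le_coe.2 (gridPoint_le hk)⟩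
  have h3 : s ∈ Set.Icc 0 (t : ℝ) := ⟨h1.1.trans hs.1.le, hs.2.trans h2.2⟩
  have hs1 := hs.1
  have hs2 := hs.2
  constructor
  · refine (h s h3 _ h1 ?_).le
    rw [Real.dist_eq, abs_lt]
    constructor <;> linarith
  · refine (h s h3 _ h2 ?_).le
    rw [Real.dist_eq, abs_lt]
    constructor <;> linarith

/-- The step function with the values of `f` at the right endpoints of the uniform partition. -/
noncomputable def gridStep (t : ℝ≥0) (f : ℝ → ℝ) (n : ℕ) : ℝ → ℝ :=
  stepFun (n + 1) (gridPoint t n) fun k ↦ f (gridPoint t n (k + 1))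

theorem tendsto_eLpNorm_sub_gridStep {t : ℝ≥0} {f : ℝ → ℝ}
    (hf : ContinuousOn f (Set.Icc 0 (t : ℝ))) :
    Tendsto (fun n ↦ eLpNorm (fun s ↦ f s - gridStep t f n s) 2
      (volume.restrict (Set.Icc 0 (t : ℝ)))) atTop (𝓝 0) := by
  rw [ENNReal.tendsto_nhds_zero]
  intro ε hε
  obtain ⟨δ, hδ, hδε⟩ : ∃ δ : ℝ, 0 < δ ∧
      (volume.restrict (Set.Icc 0 (t : ℝ)) Set.univ) ^ ((2 : ℝ≥0∞).toReal⁻¹) *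
        ENNReal.ofReal δ ≤ ε := by
    have hlim : Tendsto (fun δ : ℝ ↦ (volume.restrict (Set.Icc 0 (t : ℝ)) Set.univ) ^
        ((2 : ℝ≥0∞).toReal⁻¹) * ENNReal.ofReal δ) (𝓝[>] 0) (𝓝 0) := by
      have h1 : Tendsto (fun δ : ℝ ↦ ENNReal.ofReal δ) (𝓝[>] 0) (𝓝 0) := by
        simpa using (ENNReal.continuous_ofReal.tendsto 0).mono_left nhdsWithin_le_nhds
      have := ENNReal.Tendsto.const_mul (a := (volume.restrict (Set.Icc 0 (t : ℝ)) Set.univ) ^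
        ((2 : ℝ≥0∞).toReal⁻¹)) h1 (Or.inr (ENNReal.rpow_ne_top_of_nonneg (by norm_num)
          (measure_ne_top _ _)))
      simpa using this
    have h2 := (ENNReal.tendsto_nhds_zero.1 hlim ε hε).and self_mem_nhdsWithin
    obtain ⟨δ, h3, h4⟩ := h2.exists
    exact ⟨δ, h4, h3⟩
  filter_upwards [eventually_abs_sub_gridPoint_le hf hδ] with n hn
  refine (eLpNorm_le_of_ae_bound (C := δ) ?_).trans hδε
  -- The cells are half-open, so the null point 0 has to be removed.
  rw [← restrict_Ioc_eq_restrict_Icc]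
  refine (ae_restrict_iff' measurableSet_Ioc).2 (ae_of_all _ fun s hs ↦ ?_)
  refine abs_sub_stepFun_le (gridPoint_mono t n) (fun k hk s hs ↦ (hn k hk s hs).2) ?_
  simpa using hs

theorem tendsto_sum_gridPoint {t : ℝ≥0} {f : ℝ → ℝ} (hf : ContinuousOn f (Set.Icc 0 (t : ℝ))) :
    Tendsto (fun n ↦ ∑ k ∈ Finset.range (n + 1),
      f (gridPoint t n k) * ((gridPoint t n (k + 1) : ℝ) - gridPoint t n k)) atTop
      (𝓝 (∫ s in (0 : ℝ)..t, f s)) := by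
  have hint : ∀ n, ∫ s in (0 : ℝ)..t, stepFun (n + 1) (gridPoint t n)
      (fun k ↦ f (gridPoint t n k)) s = ∑ k ∈ Finset.range (n + 1),
      f (gridPoint t n k) * ((gridPoint t n (k + 1) : ℝ) - gridPoint t n k) ∧
      IntervalIntegrable (stepFun (n + 1) (gridPoint t n)
      (fun k ↦ f (gridPoint t n k))) volume 0 t := fun n ↦ by
    have hi : ∀ k ∈ Finset.range (n + 1), Integrable (fun s ↦ Set.indicator
        (Set.Ioc (gridPoint t n k : ℝ) (gridPoint t n (k + 1) : ℝ))
        (fun _ ↦ f (gridPoint t n k)) s) (volume.restrict (Set.Ioc 0 (t : ℝ))) := fun k _ ↦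
      (integrable_const _).indicator measurableSet_Ioc
    constructor
    · rw [intervalIntegral.integral_of_le t.coe_nonneg]
      unfold stepFun
      rw [integral_finsetSum _ hi]
      refine Finset.sum_congr rfl fun k hk ↦ ?_
      rw [integral_indicator measurableSet_Ioc, Measure.restrict_restrict measurableSet_Ioc,
        Set.inter_eq_left.2, setIntegral_const, smul_eq_mul, mul_comm, Measure.real,
        Real.volume_Ioc, ENNReal.toReal_ofReal]
      · exact sub_nonneg.2 (NNReal.coe_le_coe.2 (gridPoint_mono t n k.le_succ))
      · refine Set.Ioc_subset_Ioc (NNReal.coe_nonneg _) (NNReal.coe_le_coe.2 (gridPoint_le ?_))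
        have := Finset.mem_range.1 hk
        omega
    · rw [intervalIntegrable_iff_integrableOn_Ioc_of_le t.coe_nonneg]
      exact integrable_finsetSum _ hi
  have hfi : IntervalIntegrable f volume 0 t := by
    refine ContinuousOn.intervalIntegrable ?_
    rwa [Set.uIcc_of_le t.coe_nonneg]
  rw [Metric.tendsto_atTop']
  intro ε hε
  -- Dividing by `t + 1` allows `t = 0` and leaves a strict inequality.
  have hδ : 0 < ε / (t + 1) := by positivity
  obtain ⟨N, hN⟩ := (eventually_atTop.1 (eventually_abs_sub_gridPoint_le hf hδ))
  refine ⟨N, fun n hn ↦ ?_⟩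
  rw [← (hint n).1, dist_comm, dist_eq_norm, ← intervalIntegral.integral_sub hfi (hint n).2]
  have hb : ‖∫ s in (0 : ℝ)..t, (f s - stepFun (n + 1) (gridPoint t n)
      (fun k ↦ f (gridPoint t n k)) s)‖ ≤ ε / (t + 1) * |(t : ℝ) - 0| := by
    refine intervalIntegral.norm_integral_le_of_norm_le_const fun s hs ↦ ?_
    rw [Set.uIoc_of_le t.coe_nonneg] at hs
    refine abs_sub_stepFun_le (gridPoint_mono t n) (fun k hk s hs ↦ (hN n hn.le k hk s hs).1) ?_
    simpa using hs
  refine hb.trans_lt ?_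
  rw [sub_zero, abs_of_nonneg t.coe_nonneg, div_mul_eq_mul_div, div_lt_iff₀ (by positivity)]
  have : (0 : ℝ) ≤ t := t.coe_nonneg
  nlinarith

theorem sum_range_mul_sub (n : ℕ) (g u : ℕ → ℝ) :
    ∑ k ∈ Finset.range n, u (k + 1) * (g (k + 1) - g k) =
      ∑ k ∈ Finset.range n, g k * (u k - u (k + 1)) + (g n * u n - g 0 * u 0) := by
  rw [← Finset.sum_range_sub (fun k ↦ g k * u k), ← Finset.sum_add_distrib]
  refine Finset.sum_congr rfl fun k _ ↦ by ring

end StepFunctions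

/-! ### Brownian noise and its Gaussian space -/

section Noise

variable {Ω : Type*} [MeasurableSpace Ω] {P : Measure Ω}

/-- Independent Gaussian processes are jointly Gaussian. -/
theorem isGaussianProcess_of_iIndepFun {ι κ : Type*} {X : ι → κ → Ω → ℝ}
    (hX : ∀ i, IsGaussianProcess (X i) P) (hind : iIndepFun (fun i ω k ↦ X i k ω) P) :
    IsGaussianProcess (fun q : ι × κ ↦ X q.1 q.2) P := by
  classical
  refine ⟨fun I ↦ ?_⟩
  -- The finite index set is enlarged to a rectangle, on which the rows are independent Gaussian
  -- vectors, and then projected back.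
  set J₁ := I.image Prod.fst
  set J₂ := I.image Prod.snd
  have h1 : iIndepFun (fun (i : J₁) ω (k : J₂) ↦ X i k ω) P :=
    (hind.comp (fun _ x (k : J₂) ↦ x k) fun _ ↦ by fun_prop).precomp
      (g := ((↑) : J₁ → ι)) Subtype.val_injective
  have h2 := h1.hasGaussianLaw fun i : J₁ ↦ (hX i).hasGaussianLaw J₂
  let L : (J₁ → J₂ → ℝ) →L[ℝ] (I → ℝ) :=
    { toFun x q := x ⟨q.1.1, Finset.mem_image_of_mem _ q.2⟩ ⟨q.1.2, Finset.mem_image_of_mem _ q.2⟩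
      map_add' x y := by ext; simp
      map_smul' c x := by ext; simp }
  exact h2.map L

/-- The Brownian motion of a mode. -/
def modeNoise (β : Fin 2 → ℕ → ℕ → ℝ≥0 → Ω → ℝ) (p : ModeIndex) (s : ℝ≥0) : Ω → ℝ :=
  β p.1.1 p.1.2.1 p.1.2.2 s

theorem IsBrownianOn.isGaussianProcess {T : ℝ≥0} {B : ℝ≥0 → Ω → ℝ} (hB : IsBrownianOn T B P) :
    IsGaussianProcess (fun s : Set.Iic T ↦ B s) P := by
  refine ⟨fun I ↦ ?_⟩
  have h := (hB.hasLaw (I.map (Function.Embedding.subtype _)) fun s hs ↦ by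
    obtain ⟨s', -, rfl⟩ := Finset.mem_map.1 hs
    exact s'.2).hasGaussianLaw
  let L : (I.map (Function.Embedding.subtype (· ∈ Set.Iic T)) → ℝ) →L[ℝ] (I → ℝ) :=
    { toFun x s := x ⟨s.1.1, Finset.mem_map_of_mem _ s.2⟩
      map_add' x y := by ext; simp
      map_smul' c x := by ext; simp }
  exact h.map L

theorem IsBrownianOn.hasGaussianLaw {T : ℝ≥0} {B : ℝ≥0 → Ω → ℝ} (hB : IsBrownianOn T B P)
    {s : ℝ≥0} (hs : s ≤ T) : HasGaussianLaw (B s) P :=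
  hB.isGaussianProcess.hasGaussianLaw_eval ⟨s, hs⟩

theorem IsBrownianOn.integral_eq_zero {T : ℝ≥0} {B : ℝ≥0 → Ω → ℝ} (hB : IsBrownianOn T B P)
    {s : ℝ≥0} (hs : s ≤ T) : ∫ ω, B s ω ∂P = 0 := by
  have h := (hB.hasLaw {s} (by simpa using hs)).integral_comp
    (f := fun x ↦ x ⟨s, Finset.mem_singleton_self s⟩)
    (Measurable.aestronglyMeasurable (by fun_prop))
  rw [BrownianReal.integral_eval_projectiveFamily] at h
  exact h

theorem IsBrownianOn.integral_mul {T : ℝ≥0} {B : ℝ≥0 → Ω → ℝ} (hB : IsBrownianOn T B P)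
    [IsProbabilityMeasure P] {s r : ℝ≥0} (hs : s ≤ T) (hr : r ≤ T) :
    ∫ ω, B s ω * B r ω ∂P = min s r := by
  have h : cov[B s, B r; P] = min s r := by
    convert (hB.hasLaw {s, r} ?_).covariance_fun_comp
      (f := Function.eval ⟨s, by simp⟩) (g := fun x ↦ x ⟨r, by simp⟩) ?_ ?_
    · simp
    · simp
    · rw [BrownianReal.covariance_eval_projectiveFamily]
    · simp [hs, hr]
    all_goals exact Measurable.aemeasurable (by fun_prop)
  rw [covariance_eq_sub (hB.hasGaussianLaw hs).memLp_two (hB.hasGaussianLaw hr).memLp_two,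
    hB.integral_eq_zero hs, zero_mul, sub_zero] at h
  exact h

variable {T : ℝ≥0} {A : ℕ → ℝ} {β : Fin 2 → ℕ → ℕ → ℝ≥0 → Ω → ℝ} {t : ℝ≥0}

namespace IsIsotropicWiener

theorem isGaussianProcess (hβ : IsIsotropicWiener T A β P) :
    IsGaussianProcess (fun q : ModeIndex × Set.Iic T ↦ modeNoise β q.1 q.2) P :=
  isGaussianProcess_of_iIndepFun (X := fun (p : ModeIndex) (s : Set.Iic T) ↦ modeNoise β p s)
    (fun p ↦ IsBrownianOn.isGaussianProcess (hβ.brownian p)) hβ.indep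

theorem memLp (hβ : IsIsotropicWiener T A β P) (p : ModeIndex) {s : ℝ≥0} (hs : s ≤ T) :
    MemLp (modeNoise β p s) 2 P :=
  ((hβ.brownian p).hasGaussianLaw hs).memLp_two

theorem integral_mul [IsProbabilityMeasure P] (hβ : IsIsotropicWiener T A β P) (p q : ModeIndex)
    {s r : ℝ≥0} (hs : s ≤ T) (hr : r ≤ T) :
    ∫ ω, modeNoise β p s ω * modeNoise β q r ω ∂P =
      (if p = q then 1 else 0) * (min s r : ℝ≥0) := by
  split_ifs with h
  · subst h
    rw [one_mul]
    exact_mod_cast (hβ.brownian p).integral_mul hs hr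
  · have hi : IndepFun (modeNoise β p s) (modeNoise β q r) P :=
      (hβ.indep.indepFun h).comp (φ := fun x : Set.Iic T → ℝ ↦ x ⟨s, hs⟩)
        (ψ := fun x : Set.Iic T → ℝ ↦ x ⟨r, hr⟩) (by fun_prop) (by fun_prop)
    rw [hi.integral_fun_mul_eq_mul_integral (hβ.memLp p hs).1 (hβ.memLp q hr).1,
      show ∫ ω, modeNoise β p s ω ∂P = 0 from (hβ.brownian p).integral_eq_zero hs, zero_mul,
      zero_mul]

variable (hβ : IsIsotropicWiener T A β P) (ht : t ≤ T)

/-- The class of the Brownian motion of a mode, stopped at the time `t`. -/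
noncomputable def noiseLp (p : ModeIndex) (s : ℝ≥0) : Lp ℝ 2 P :=
  (hβ.memLp p ((min_le_right s t).trans ht)).toLp _

/-- The closed Gaussian space of the noise up to the time `t`. -/
noncomputable def noiseSpace : Submodule ℝ (Lp ℝ 2 P) :=
  (Submodule.span ℝ (Set.range fun q : ModeIndex × Set.Iic T ↦
    processLp (Y := fun q : ModeIndex × Set.Iic T ↦ modeNoise β q.1 q.2)
      (fun q ↦ hβ.memLp q.1 q.2.2) q)).topologicalClosure

theorem noiseSpace_subset [IsProbabilityMeasure P] :
    (hβ.noiseSpace : Set (Lp ℝ 2 P)) ⊆ centeredGaussians P :=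
  span_processLp_subset hβ.isGaussianProcess
    (fun q ↦ (hβ.brownian q.1).integral_eq_zero q.2.2) _

theorem noiseLp_mem (p : ModeIndex) (s : ℝ≥0) : hβ.noiseLp ht p s ∈ hβ.noiseSpace :=
  Submodule.le_topologicalClosure _
    (Submodule.subset_span ⟨(p, ⟨min s t, (min_le_right s t).trans ht⟩), rfl⟩)

end IsIsotropicWiener

/-- The class of the indicator function of `(0, s]` in `L²(0,t)`. -/
noncomputable def indicatorLp (t s : ℝ≥0) : Lp ℝ 2 (volume.restrict (Set.Icc 0 (t : ℝ))) :=
  indicatorConstLp 2 (measurableSet_Ioc (a := (0 : ℝ)) (b := s)) (measure_ne_top _ _) 1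

/-- This is the covariance of Brownian motion stopped at `t`, the source of the Itô isometry. -/
theorem inner_indicatorLp (t s r : ℝ≥0) :
    inner ℝ (indicatorLp t s) (indicatorLp t r) = (min (min s t) (min r t) : ℝ≥0) := by
  rw [indicatorLp, indicatorLp, L2.inner_indicatorConstLp_indicatorConstLp, measureReal_def,
    ← restrict_Ioc_eq_restrict_Icc, Measure.restrict_apply (by measurability), Set.Ioc_inter_Ioc,
    Set.Ioc_inter_Ioc]
  simp only [max_self, sub_zero, Real.volume_Ioc]
  rw [ENNReal.toReal_ofReal (by positivity)]
  simp [min_comm, min_left_comm]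

/-- The combination of times that represents a step function. -/
noncomputable def stepTimes (n : ℕ) (τ : ℕ → ℝ≥0) (c : ℕ → ℝ) : ℝ≥0 →₀ ℝ :=
  ∑ k ∈ Finset.range n, (Finsupp.single (τ (k + 1)) (c k) - Finsupp.single (τ k) (c k))

theorem linearCombination_stepTimes {H : Type*} [AddCommGroup H] [Module ℝ H] (W : ℝ≥0 → H)
    (n : ℕ) (τ : ℕ → ℝ≥0) (c : ℕ → ℝ) :
    Finsupp.linearCombination ℝ W (stepTimes n τ c) =
      ∑ k ∈ Finset.range n, c k • (W (τ (k + 1)) - W (τ k)) := by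
  simp [stepTimes, smul_sub]

theorem coeFn_sum_smul_sub {α : Type*} [MeasurableSpace α] {μ : Measure α} (n : ℕ) (c : ℕ → ℝ)
    {W : ℕ → Lp ℝ 2 μ} {w : ℕ → α → ℝ} (hw : ∀ k ≤ n, W k =ᵐ[μ] w k) :
    ⇑(∑ k ∈ Finset.range n, c k • (W (k + 1) - W k) : Lp ℝ 2 μ) =ᵐ[μ]
      fun x ↦ ∑ k ∈ Finset.range n, c k * (w (k + 1) x - w k x) := by
  refine (Lp.coeFn_finsetSum _ _).trans ?_
  have h : ∀ᵐ x ∂μ, ∀ k ∈ Finset.range n,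
      (c k • (W (k + 1) - W k) : Lp ℝ 2 μ) x = c k * (w (k + 1) x - w k x) := by
    refine (ae_ball_iff (Finset.range n).countable_toSet).2 fun k hk ↦ ?_
    have hk' := Finset.mem_range.1 hk
    filter_upwards [Lp.coeFn_smul (c k) (W (k + 1) - W k), Lp.coeFn_sub (W (k + 1)) (W k),
      hw (k + 1) hk', hw k hk'.le] with x h1 h2 h3 h4
    rw [h1, Pi.smul_apply, h2, Pi.sub_apply, h3, h4, smul_eq_mul]
  filter_upwards [h] with x hx
  rw [Finset.sum_apply]
  exact Finset.sum_congr rfl hx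

theorem coeFn_linearCombination_indicatorLp (t : ℝ≥0) {n : ℕ} {τ : ℕ → ℝ≥0} (hτ : Monotone τ)
    (c : ℕ → ℝ) : ⇑(Finsupp.linearCombination ℝ (indicatorLp t) (stepTimes n τ c))
      =ᵐ[volume.restrict (Set.Icc 0 (t : ℝ))] stepFun n τ c := by
  rw [linearCombination_stepTimes]
  refine (coeFn_sum_smul_sub n c (W := fun k ↦ indicatorLp t (τ k))
    fun k _ ↦ indicatorConstLp_coeFn).trans (ae_of_all _ fun s ↦ ?_)
  simp only [stepFun]
  refine Finset.sum_congr rfl fun k _ ↦ ?_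
  have h : (τ k : ℝ) ≤ τ (k + 1) := NNReal.coe_le_coe.2 (hτ k.le_succ)
  have h0 : (0 : ℝ) ≤ τ k := NNReal.coe_nonneg _
  simp only [Set.indicator, Set.mem_Ioc]
  split_ifs <;> first | (exfalso; grind) | ring

namespace IsIsotropicWiener

variable (hβ : IsIsotropicWiener T A β P) (ht : t ≤ T)

theorem coeFn_linearCombination_noiseLp (p : ModeIndex) {n : ℕ} {τ : ℕ → ℝ≥0} (hτ : Monotone τ)
    (hτt : τ n ≤ t) (c : ℕ → ℝ) :
    ⇑(Finsupp.linearCombination ℝ (hβ.noiseLp ht p) (stepTimes n τ c)) =ᵐ[P]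
      fun ω ↦ ∑ k ∈ Finset.range n, c k * (modeNoise β p (τ (k + 1)) ω - modeNoise β p (τ k) ω) := by
  rw [linearCombination_stepTimes]
  refine coeFn_sum_smul_sub n c (W := fun k ↦ hβ.noiseLp ht p (τ k))
    (w := fun k ↦ modeNoise β p (τ k)) fun k hk ↦ ?_
  refine (MemLp.coeFn_toLp _).trans (Eq.eventuallyEq ?_)
  -- Stopping at `t` has no effect, since all partition points lie below `τ n ≤ t`.
  rw [min_eq_left ((hτ hk).trans hτt)]

theorem inner_noiseLp [IsProbabilityMeasure P] (p q : ModeIndex) (s r : ℝ≥0) :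
    inner ℝ (hβ.noiseLp ht p s) (hβ.noiseLp ht q r) =
      (if p = q then 1 else 0) * inner ℝ (indicatorLp t s) (indicatorLp t r) := by
  rw [noiseLp, noiseLp, inner_toLp, inner_indicatorLp,
    hβ.integral_mul p q ((min_le_right s t).trans ht) ((min_le_right r t).trans ht)]

theorem norm_linearCombination_noiseLp [IsProbabilityMeasure P] (p : ModeIndex) (c : ℝ≥0 →₀ ℝ) :
    ‖Finsupp.linearCombination ℝ (hβ.noiseLp ht p) c‖ =
      ‖Finsupp.linearCombination ℝ (indicatorLp t) c‖ := by
  have h := inner_linearCombination_eq (hβ.inner_noiseLp ht p p) c c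
  rw [if_pos rfl, one_mul, real_inner_self_eq_norm_sq, real_inner_self_eq_norm_sq] at h
  exact (sq_eq_sq₀ (norm_nonneg _) (norm_nonneg _)).1 h

end IsIsotropicWiener

theorem memLp_restrict_Icc {t : ℝ≥0} {f : ℝ → ℝ} (hf : Continuous f) :
    MemLp f 2 (volume.restrict (Set.Icc 0 (t : ℝ))) := by
  obtain ⟨K, hK⟩ := (isCompact_Icc (a := (0 : ℝ)) (b := t)).exists_bound_of_continuousOn
    hf.continuousOn
  exact MemLp.of_bound hf.aestronglyMeasurable K
    ((ae_restrict_iff' measurableSet_Icc).2 (ae_of_all _ hK))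

end Noise

/-! ### The matrices `C_l(t)` and their Cholesky factors -/

section Covariance

/-- The kernel of the stochastic convolution, with the limit `(u, 1)` of `waveKernel` for `l = 0`. -/
noncomputable def propagator (l : ℕ) (j : Fin 2) (u : ℝ) : ℝ :=
  if l = 0 then ![u, 1] j else waveKernel l j u

theorem continuous_propagator (l : ℕ) (j : Fin 2) : Continuous (propagator l j) := by
  unfold propagator waveKernel
  split_ifs <;> fin_cases j <;> simp <;> fun_prop

theorem lam_pos {l : ℕ} (hl : l ≠ 0) : 0 < lam l := by
  unfold lam
  positivity

theorem covMatrix_of_ne_zero {l : ℕ} (hl : l ≠ 0) (t : ℝ) :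
    covMatrix l t = !![(2 * Real.sqrt (lam l) * t - Real.sin (2 * (Real.sqrt (lam l) * t))) /
        (4 * Real.sqrt (lam l) ^ 3), Real.sin (Real.sqrt (lam l) * t) ^ 2 / (2 * Real.sqrt (lam l) ^ 2);
      Real.sin (Real.sqrt (lam l) * t) ^ 2 / (2 * Real.sqrt (lam l) ^ 2),
      (2 * Real.sqrt (lam l) * t + Real.sin (2 * (Real.sqrt (lam l) * t))) /
        (4 * Real.sqrt (lam l))] := by
  have h3 : lam l ^ (3 / 2 : ℝ) = Real.sqrt (lam l) ^ 3 := by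
    rw [Real.sqrt_eq_rpow, ← Real.rpow_natCast, ← Real.rpow_mul (lam_pos hl).le]
    norm_num
  rw [covMatrix, if_neg hl, h3, ← Real.sqrt_eq_rpow, Real.sq_sqrt (lam_pos hl).le, mul_assoc]

theorem covMatrix_zero_right (l : ℕ) (j k : Fin 2) : covMatrix l 0 j k = 0 := by
  by_cases hl : l = 0
  · subst hl
    fin_cases j <;> fin_cases k <;> simp [covMatrix]
  · rw [covMatrix_of_ne_zero hl]
    fin_cases j <;> fin_cases k <;> simp

/-- Differentiation and the double-angle formula confirm that the stated entries are primitives of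
the kernel products. -/
theorem hasDerivAt_covMatrix (l : ℕ) (j k : Fin 2) (x : ℝ) :
    HasDerivAt (fun t ↦ covMatrix l t j k) (propagator l j x * propagator l k x) x := by
  by_cases hl : l = 0
  · subst hl
    have h3 : HasDerivAt (fun t : ℝ ↦ t ^ 3 / 3) (x * x) x := by
      exact ((hasDerivAt_pow 3 x).div_const 3).congr_deriv (by push_cast; ring)
    have h2 : HasDerivAt (fun t : ℝ ↦ t ^ 2 / 2) x x := by
      exact ((hasDerivAt_pow 2 x).div_const 2).congr_deriv (by push_cast; ring)
    have h1 : HasDerivAt (fun t : ℝ ↦ t) 1 x := hasDerivAt_id x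
    fin_cases j <;> fin_cases k <;> simp [covMatrix, propagator]
    · simpa using h3
    · simpa using h2
    · simpa using h2
    · simpa using h1
  · simp only [covMatrix_of_ne_zero hl, propagator, if_neg hl, waveKernel]
    set r := Real.sqrt (lam l)
    have hr : r ≠ 0 := (Real.sqrt_pos.2 (lam_pos hl)).ne'
    have hlin : HasDerivAt (fun t : ℝ ↦ r * t) r x := by
      simpa using (hasDerivAt_id x).const_mul r
    have hlin2 : HasDerivAt (fun t : ℝ ↦ 2 * r * t) (2 * r) x := by
      simpa using (hasDerivAt_id x).const_mul (2 * r)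
    have hs2 := (hlin.const_mul 2).sin
    have hs := hlin.sin
    have h00 := (hlin2.sub hs2).div_const (4 * r ^ 3)
    have h11 := (hlin2.add hs2).div_const (4 * r)
    have h01 := (hs.pow 2).div_const (2 * r ^ 2)
    have e := Real.sin_sq_add_cos_sq (r * x)
    rw [Real.cos_two_mul] at h00 h11
    have e00 : (2 * r - (2 * Real.cos (r * x) ^ 2 - 1) * (2 * r)) / (4 * r ^ 3) =
        (r⁻¹ * Real.sin (x * r)) * (r⁻¹ * Real.sin (x * r)) := by
      rw [mul_comm x r]
      field_simp
      linear_combination (-4) * e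
    have e11 : (2 * r + (2 * Real.cos (r * x) ^ 2 - 1) * (2 * r)) / (4 * r) =
        Real.cos (x * r) * Real.cos (x * r) := by
      rw [mul_comm x r]
      field_simp
      ring
    have e01 : ((2 : ℕ) : ℝ) * Real.sin (r * x) ^ (2 - 1) * (Real.cos (r * x) * r) / (2 * r ^ 2) =
        (r⁻¹ * Real.sin (x * r)) * Real.cos (x * r) := by
      rw [mul_comm x r]
      norm_num
      field_simp
    rw [e00] at h00
    rw [e11] at h11
    rw [e01] at h01
    fin_cases j <;> fin_cases k
    · exact h00
    · exact h01
    · exact h01.congr_deriv (mul_comm _ _)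
    · exact h11

theorem integral_propagator_mul (l : ℕ) (j k : Fin 2) (t : ℝ) :
    ∫ s in (0 : ℝ)..t, propagator l j (t - s) * propagator l k (t - s) = covMatrix l t j k := by
  have hc : Continuous fun x ↦ propagator l j x * propagator l k x :=
    (continuous_propagator l j).mul (continuous_propagator l k)
  rw [intervalIntegral.integral_comp_sub_left fun x ↦ propagator l j x * propagator l k x,
    intervalIntegral.integral_eq_sub_of_hasDerivAt (fun x _ ↦ hasDerivAt_covMatrix l j k x)
      (hc.intervalIntegrable _ _)]
  simp [covMatrix_zero_right]

/-- The bound has to be uniform in `l`; for the sine entry it comes from `|sin (u r)| ≤ u r`, which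
cancels the factor `1/r`. -/
theorem abs_propagator_le (l : ℕ) (j : Fin 2) {u : ℝ} (hu : 0 ≤ u) : |propagator l j u| ≤ u + 1 := by
  unfold propagator
  split_ifs with hl
  · fin_cases j <;> simp [abs_of_nonneg hu, hu]
  · have hr : 0 < Real.sqrt (lam l) := Real.sqrt_pos.2 (lam_pos hl)
    fin_cases j
    · simp only [waveKernel, Fin.zero_eta, Matrix.cons_val_zero]
      rw [abs_mul, abs_of_pos (inv_pos.2 hr)]
      have h1 : |Real.sin (u * Real.sqrt (lam l))| ≤ u * Real.sqrt (lam l) := by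
        have := Real.abs_sin_le_abs (x := u * Real.sqrt (lam l))
        rwa [abs_of_nonneg (by positivity : 0 ≤ u * Real.sqrt (lam l))] at this
      calc _ ≤ (Real.sqrt (lam l))⁻¹ * (u * Real.sqrt (lam l)) := by gcongr
        _ = u := by field_simp
        _ ≤ _ := by linarith
    · simp only [waveKernel, Fin.mk_one, Matrix.cons_val_one, Matrix.cons_val_fin_one]
      have := Real.abs_cos_le_one (u * Real.sqrt (lam l))
      linarith

theorem covMatrix_diag_le (l : ℕ) (j : Fin 2) {t : ℝ} (ht : 0 ≤ t) :
    covMatrix l t j j ≤ (t + 1) ^ 2 * t := by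
  rw [← integral_propagator_mul]
  refine (le_abs_self _).trans ?_
  have := intervalIntegral.norm_integral_le_of_norm_le_const (a := 0) (b := t) (C := (t + 1) ^ 2)
    (f := fun s ↦ propagator l j (t - s) * propagator l j (t - s)) fun s hs ↦ by
      rw [Set.uIoc_of_le ht] at hs
      have h := abs_propagator_le l j (u := t - s) (by linarith [hs.2])
      rw [norm_mul, ← sq, Real.norm_eq_abs]
      have h' : |propagator l j (t - s)| ≤ t + 1 := by linarith [hs.1]
      gcongr
  rwa [sub_zero, abs_of_nonneg ht] at this

/-- A positive first pivot determines the first column by division. The last entry is then a square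
root, so a zero determinant is allowed. -/
theorem existsUnique_isCholeskyFactor {M : Matrix (Fin 2) (Fin 2) ℝ} (h0 : 0 < M 0 0)
    (hs : M 1 0 = M 0 1) (hd : M 0 1 ^ 2 ≤ M 0 0 * M 1 1) : ∃! D, IsCholeskyFactor D M := by
  set a := Real.sqrt (M 0 0) with ha
  have ha0 : 0 < a := Real.sqrt_pos.2 h0
  have ha2 : a ^ 2 = M 0 0 := Real.sq_sqrt h0.le
  set b := M 0 1 / a with hb
  have hab : a * b = M 0 1 := by rw [hb]; field_simp
  have hc0 : 0 ≤ M 1 1 - b ^ 2 := by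
    have : a ^ 2 * b ^ 2 ≤ a ^ 2 * M 1 1 := by rw [← mul_pow, hab, ha2]; exact hd
    have := le_of_mul_le_mul_left this (by positivity)
    linarith
  set c := Real.sqrt (M 1 1 - b ^ 2) with hc
  have hc2 : c ^ 2 = M 1 1 - b ^ 2 := Real.sq_sqrt hc0
  refine ⟨!![a, 0; b, c], ⟨?_, ?_, ?_⟩, ?_⟩
  · intro i j hij
    fin_cases i <;> fin_cases j <;> simp_all
  · intro i
    fin_cases i
    · exact ha0.le
    · exact Real.sqrt_nonneg _
  · ext i j
    fin_cases i <;> fin_cases j <;> simp [Matrix.mul_apply, Fin.sum_univ_two]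
    · linear_combination ha2
    · exact hab
    · rw [hs]
      linear_combination hab
    · linear_combination hc2
  · intro D hD
    have e := fun i j ↦ congrFun (congrFun hD.mul_transpose i) j
    have l01 := hD.lower 0 1 (by decide)
    have e00 := e 0 0
    have e01 := e 0 1
    have e11 := e 1 1
    simp only [Matrix.mul_apply, Fin.sum_univ_two, Matrix.transpose_apply, l01, mul_zero, zero_mul,
      add_zero] at e00 e01 e11
    have d00 : D 0 0 = a := by
      rw [ha, ← e00, Real.sqrt_mul_self (hD.diag_nonneg 0)]
    have d10 : D 1 0 = b := by
      rw [d00] at e01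
      exact mul_left_cancel₀ ha0.ne' (e01.trans hab.symm)
    have d11 : D 1 1 = c := by
      rw [hc, ← e11, d10, ← sq b, add_sub_cancel_left, Real.sqrt_mul_self (hD.diag_nonneg 1)]
    ext i j
    fin_cases i <;> fin_cases j <;> simp [l01, d00, d10, d11]

theorem existsUnique_isCholeskyFactor_zero : ∃! D, IsCholeskyFactor D 0 := by
  refine ⟨0, ⟨by simp, by simp, by simp⟩, fun D hD ↦ ?_⟩
  have e := fun i ↦ congrFun (congrFun hD.mul_transpose i) i
  simp only [Matrix.mul_apply, Fin.sum_univ_two, Matrix.transpose_apply, Matrix.zero_apply] at e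
  ext i j
  have := e i
  fin_cases j <;> simp <;> nlinarith [mul_self_nonneg (D i 0), mul_self_nonneg (D i 1)]

theorem existsUnique_isCholeskyFactor_covMatrix (l : ℕ) {t : ℝ} (ht : 0 ≤ t) :
    ∃! D, IsCholeskyFactor D (covMatrix l t) := by
  -- At `t = 0` the matrix vanishes and there is no positive pivot.
  rcases ht.eq_or_lt with rfl | ht
  · have : covMatrix l 0 = 0 := by
      ext j k
      exact covMatrix_zero_right l j k
    rw [this]
    exact existsUnique_isCholeskyFactor_zero
  by_cases hl : l = 0
  · subst hl
    refine existsUnique_isCholeskyFactor ?_ ?_ ?_ <;> simp [covMatrix]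
    · positivity
    · have : 0 < t ^ 4 := by positivity
      nlinarith
  · rw [covMatrix_of_ne_zero hl]
    have hr : 0 < Real.sqrt (lam l) := Real.sqrt_pos.2 (lam_pos hl)
    set r := Real.sqrt (lam l)
    refine existsUnique_isCholeskyFactor ?_ ?_ ?_ <;> simp
    · have := Real.sin_lt (x := 2 * (r * t)) (by positivity)
      refine div_pos ?_ (by positivity)
      linarith
    · have h1 : Real.sin (r * t) ^ 2 ≤ (r * t) ^ 2 := by
        rw [sq_le_sq]
        exact Real.abs_sin_le_abs
      have e := Real.sin_sq_add_cos_sq (r * t)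
      rw [Real.sin_two_mul, div_mul_div_comm, div_pow, div_le_div_iff₀ (by positivity)
        (by positivity)]
      -- With `x = r t`, the determinant condition reads `sin⁴ x + sin² x cos² x ≤ x²`, which is
      -- `sin² x ≤ x²`.
      have key : (Real.sin (r * t) ^ 2) ^ 2 * 4 ≤
          (2 * r * t - 2 * Real.sin (r * t) * Real.cos (r * t)) *
            (2 * r * t + 2 * Real.sin (r * t) * Real.cos (r * t)) := by
        have : (Real.sin (r * t) ^ 2) ^ 2 = Real.sin (r * t) ^ 2 * (1 - Real.cos (r * t) ^ 2) := by
          rw [← e]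
          ring
        nlinarith
      nlinarith [mul_le_mul_of_nonneg_right key (by positivity : 0 ≤ 4 * r ^ 4)]

end Covariance

/-! ### Wiener integrals of continuous functions -/

section WienerIntegral

variable {Ω : Type*} [MeasurableSpace Ω] {P : Measure Ω}
variable {T : ℝ≥0} {A : ℕ → ℝ} {β : Fin 2 → ℕ → ℕ → ℝ≥0 → Ω → ℝ} {t : ℝ≥0}

/-- The combination of times that represents `gridStep`. -/
noncomputable def gridTimes (t : ℝ≥0) (f : ℝ → ℝ) (n : ℕ) : ℝ≥0 →₀ ℝ :=
  stepTimes (n + 1) (gridPoint t n) fun k ↦ f (gridPoint t n (k + 1))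

theorem norm_toLp_sub_stepTimes {f : ℝ → ℝ} (hf : Continuous f) {n : ℕ} {τ : ℕ → ℝ≥0}
    (hτ : Monotone τ) (c : ℕ → ℝ) :
    ‖(memLp_restrict_Icc (t := t) hf).toLp f -
        Finsupp.linearCombination ℝ (indicatorLp t) (stepTimes n τ c)‖ₑ =
      eLpNorm (fun s ↦ f s - stepFun n τ c s) 2 (volume.restrict (Set.Icc 0 (t : ℝ))) := by
  rw [Lp.enorm_def]
  refine eLpNorm_congr_ae ?_
  filter_upwards [Lp.coeFn_sub ((memLp_restrict_Icc (t := t) hf).toLp f)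
    (Finsupp.linearCombination ℝ (indicatorLp t) (stepTimes n τ c)),
    (memLp_restrict_Icc (t := t) hf).coeFn_toLp,
    coeFn_linearCombination_indicatorLp t hτ c] with s h1 h2 h3
  rw [h1, Pi.sub_apply, h2, h3]

theorem tendsto_gridTimes {f : ℝ → ℝ} (hf : Continuous f) :
    Tendsto (fun n ↦ Finsupp.linearCombination ℝ (indicatorLp t) (gridTimes t f n)) atTop
      (𝓝 ((memLp_restrict_Icc (t := t) hf).toLp f)) := by
  rw [tendsto_iff_edist_tendsto_0]
  refine (tendsto_eLpNorm_sub_gridStep (t := t) hf.continuousOn).congr fun n ↦ ?_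
  rw [edist_comm, edist_eq_enorm_sub]
  exact (norm_toLp_sub_stepTimes hf (gridPoint_mono t n) _).symm

theorem toLp_mem_closure_range {f : ℝ → ℝ} (hf : Continuous f) :
    (memLp_restrict_Icc (t := t) hf).toLp f ∈
      closure (Set.range (Finsupp.linearCombination ℝ (indicatorLp t))) :=
  mem_closure_of_tendsto (tendsto_gridTimes hf) (Eventually.of_forall fun _ ↦ ⟨_, rfl⟩)

namespace IsIsotropicWiener

variable [IsProbabilityMeasure P] (hβ : IsIsotropicWiener T A β P) (ht : t ≤ T)

/-- The Wiener integral over `[0, t]` of a continuous function with respect to the noise of a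
mode. -/
noncomputable def wienerLp (p : ModeIndex) {f : ℝ → ℝ} (hf : Continuous f) : Lp ℝ 2 P :=
  (exists_norm_sub_eq_of_mem_closure _ _ (hβ.norm_linearCombination_noiseLp ht p)
    (toLp_mem_closure_range (t := t) hf)).choose

theorem norm_wienerLp_sub (p : ModeIndex) {f : ℝ → ℝ} (hf : Continuous f) (c : ℝ≥0 →₀ ℝ) :
    ‖hβ.wienerLp ht p hf - Finsupp.linearCombination ℝ (hβ.noiseLp ht p) c‖ =
      ‖(memLp_restrict_Icc (t := t) hf).toLp f - Finsupp.linearCombination ℝ (indicatorLp t) c‖ :=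
  (exists_norm_sub_eq_of_mem_closure _ _ (hβ.norm_linearCombination_noiseLp ht p)
    (toLp_mem_closure_range (t := t) hf)).choose_spec c

theorem wienerLp_mem (p : ModeIndex) {f : ℝ → ℝ} (hf : Continuous f) :
    hβ.wienerLp ht p hf ∈ hβ.noiseSpace := by
  have h := tendsto_of_norm_sub_eq (hβ.norm_wienerLp_sub ht p hf) (tendsto_gridTimes hf)
  refine IsClosed.mem_of_tendsto (Submodule.isClosed_topologicalClosure _) h
    (Eventually.of_forall fun n ↦ ?_)
  rw [SetLike.mem_coe, Finsupp.linearCombination_apply]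
  exact Submodule.sum_mem _ fun s _ ↦ Submodule.smul_mem _ _ (hβ.noiseLp_mem ht p s)

/-- The Itô isometry in polarized form, extended from indicator functions by density. -/
theorem inner_wienerLp (p q : ModeIndex) {f g : ℝ → ℝ} (hf : Continuous f) (hg : Continuous g) :
    inner ℝ (hβ.wienerLp ht p hf) (hβ.wienerLp ht q hg) =
      if p = q then ∫ s in (0 : ℝ)..t, f s * g s else 0 := by
  rw [inner_eq_of_norm_sub_eq (κ := if p = q then 1 else 0)
    (inner_linearCombination_eq (hβ.inner_noiseLp ht p q)) (toLp_mem_closure_range hf)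
    (toLp_mem_closure_range hg) (hβ.norm_wienerLp_sub ht p hf) (hβ.norm_wienerLp_sub ht q hg),
    inner_toLp, intervalIntegral.integral_of_le t.coe_nonneg, ← restrict_Ioc_eq_restrict_Icc]
  split_ifs <;> simp

theorem eLpNorm_wienerLp_sub (p : ModeIndex) {f : ℝ → ℝ} (hf : Continuous f) {n : ℕ}
    {τ : ℕ → ℝ≥0} (hτ : Monotone τ) (hτt : τ n ≤ t) (c : ℕ → ℝ) :
    eLpNorm (fun ω ↦ hβ.wienerLp ht p hf ω -
        ∑ k ∈ Finset.range n, c k * (modeNoise β p (τ (k + 1)) ω - modeNoise β p (τ k) ω)) 2 P =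
      eLpNorm (fun s ↦ f s - stepFun n τ c s) 2 (volume.restrict (Set.Icc 0 (t : ℝ))) := by
  rw [← norm_toLp_sub_stepTimes hf hτ, ← ofReal_norm, ← hβ.norm_wienerLp_sub ht p hf, ofReal_norm,
    Lp.enorm_def]
  refine eLpNorm_congr_ae ?_
  filter_upwards [Lp.coeFn_sub (hβ.wienerLp ht p hf)
    (Finsupp.linearCombination ℝ (hβ.noiseLp ht p) (stepTimes n τ c)),
    hβ.coeFn_linearCombination_noiseLp ht p hτ hτt c] with ω h1 h2
  rw [h1, Pi.sub_apply, h2]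

theorem continuous_propagator_sub (l : ℕ) (j : Fin 2) (t : ℝ) :
    Continuous fun s ↦ propagator l j (t - s) :=
  (continuous_propagator l j).comp (by fun_prop)

/-- The stochastic convolutions of the Brownian motions of the modes. -/
noncomputable def convWeight (ω : Ω) (j i : Fin 2) (l m : ℕ) : ℝ :=
  if h : m ≤ l ∧ (i = 1 → 1 ≤ m) then
    hβ.wienerLp ht ⟨(i, l, m), h⟩ (continuous_propagator_sub l j t) ω
  else 0

theorem weightVar_convWeight (p : ModeIndex) (j : Fin 2) :
    weightVar (hβ.convWeight ht) (p, j) =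
      hβ.wienerLp ht p (continuous_propagator_sub p.1.2.1 j t) := by
  ext ω
  exact dif_pos p.2

/-- All Wiener integrals lie in the Gaussian space of the noise, and the isometry turns their
covariances into the integrals that define `C_l(t)`. -/
theorem isGaussianWeights_convWeight :
    IsGaussianWeights (fun l ↦ covMatrix l t) (hβ.convWeight ht) P where
  gaussian := isGaussianProcess_of_mem_centeredGaussians hβ.noiseSpace_subset
    (F := fun q : ModeIndex × Fin 2 ↦ hβ.wienerLp ht q.1 (continuous_propagator_sub q.1.1.2.1 q.2 t))
    (fun _ ↦ hβ.wienerLp_mem ht _ _) fun q ↦ Eq.eventuallyEq (hβ.weightVar_convWeight ht q.1 q.2)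
  mean q := by
    rw [← Prod.mk.eta (p := q), weightVar_convWeight]
    exact integral_eq_zero_of_mem_centeredGaussians (hβ.noiseSpace_subset (hβ.wienerLp_mem ht _ _))
  cov p j q k := by
    rw [weightVar_convWeight, weightVar_convWeight]
    have h := hβ.inner_wienerLp ht p q (continuous_propagator_sub p.1.2.1 j t)
      (continuous_propagator_sub q.1.2.1 k t)
    rw [L2.inner_def] at h
    have e : ∀ ω, hβ.wienerLp ht p (continuous_propagator_sub p.1.2.1 j t) ω *
        hβ.wienerLp ht q (continuous_propagator_sub q.1.2.1 k t) ω =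
        inner ℝ (hβ.wienerLp ht p (continuous_propagator_sub p.1.2.1 j t) ω)
          (hβ.wienerLp ht q (continuous_propagator_sub q.1.2.1 k t) ω) := fun ω ↦ by
      simp [mul_comm]
    simp_rw [e, h]
    split_ifs with hpq
    · subst hpq
      exact integral_propagator_mul _ _ _ _
    · rfl

end IsIsotropicWiener

end WienerIntegral

/-! ### Complex coefficients and uniqueness of the Wiener integral -/

section Coefficients

/-- The coefficients with respect to the complex basis are combinations of the weights of at most
two modes. -/
theorem exists_fieldCoeff_eq {A : ℕ → ℝ} {l : ℕ} {m : ℤ} (hA : 0 ≤ A l) (hm : |m| ≤ (l : ℤ)) :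
    ∃ (α γ : ℂ) (p q : ModeIndex), p.1.2.1 = l ∧ q.1.2.1 = l ∧ (γ = 0 ∨ p ≠ q) ∧
      α * (starRingEnd ℂ) α + γ * (starRingEnd ℂ) γ = (A l : ℂ) ∧
      ∀ d : Fin 2 → ℕ → ℕ → ℝ, fieldCoeff A d l m =
        α * (d p.1.1 p.1.2.1 p.1.2.2 : ℂ) + γ * (d q.1.1 q.1.2.1 q.1.2.2 : ℂ) := by
  have hs : ∀ x : ℝ, 0 ≤ x → (Real.sqrt x : ℂ) * (Real.sqrt x : ℂ) = x := fun x hx ↦ by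
    rw [← Complex.ofReal_mul, Real.mul_self_sqrt hx]
  have hs2 := hs (A l / 2) (by positivity)
  have hp : ∀ k : ℕ, ((-1 : ℂ) ^ k) * (-1) ^ k = 1 := fun k ↦ by
    rw [← mul_pow]
    norm_num
  have hl : m.natAbs ≤ l := by
    have := abs_le.1 hm
    omega
  by_cases h0 : m = 0
  · refine ⟨Real.sqrt (A l), 0, ⟨(0, l, 0), by simp⟩, ⟨(0, l, 0), by simp⟩, rfl, rfl, Or.inl rfl,
      ?_, fun d ↦ by simp [fieldCoeff, h0]⟩
    rw [Complex.conj_ofReal, hs _ hA]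
    simp
  have h1 : 1 ≤ m.natAbs := by omega
  by_cases hpos : 0 < m
  · refine ⟨Real.sqrt (A l / 2), -(Real.sqrt (A l / 2) * Complex.I), ⟨(0, l, m.natAbs), hl, by simp⟩,
      ⟨(1, l, m.natAbs), hl, fun _ ↦ h1⟩, rfl, rfl, Or.inr (by simp), ?_, fun d ↦ ?_⟩
    · simp only [map_neg, map_mul, Complex.conj_ofReal, Complex.conj_I]
      push_cast at hs2 ⊢
      linear_combination 2 * hs2 - (Real.sqrt (A l / 2) : ℂ) ^ 2 * Complex.I_sq - hs2 + hs2
    · simp only [fieldCoeff, if_neg h0, if_pos hpos]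
      ring
  · refine ⟨(-1) ^ m.natAbs * Real.sqrt (A l / 2), (-1) ^ m.natAbs * Real.sqrt (A l / 2) * Complex.I,
      ⟨(0, l, m.natAbs), hl, by simp⟩,
      ⟨(1, l, m.natAbs), hl, fun _ ↦ h1⟩, rfl, rfl, Or.inr (by simp), ?_, fun d ↦ ?_⟩
    · simp only [map_neg, map_mul, map_pow, map_one, Complex.conj_ofReal, Complex.conj_I]
      push_cast at hs2 ⊢
      have := hp m.natAbs
      linear_combination 2 * hs2 - (Real.sqrt (A l / 2) : ℂ) ^ 2 * Complex.I_sq *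
        ((-1) ^ m.natAbs * (-1) ^ m.natAbs) +
        2 * ((Real.sqrt (A l / 2) : ℂ) * (Real.sqrt (A l / 2) : ℂ)) * this
    · simp only [fieldCoeff, if_neg h0, if_neg hpos]
      ring

theorem stepIntegral_noiseCoeff {Ω : Type*} {A : ℕ → ℝ} {β : Fin 2 → ℕ → ℕ → ℝ≥0 → Ω → ℝ} {l : ℕ} {m : ℤ} {α γ : ℂ} {p q : ModeIndex}
    (hd : ∀ d : Fin 2 → ℕ → ℕ → ℝ, fieldCoeff A d l m =
        α * (d p.1.1 p.1.2.1 p.1.2.2 : ℂ) + γ * (d q.1.1 q.1.2.1 q.1.2.2 : ℂ))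
    (n : ℕ) (τ : ℕ → ℝ≥0) (c : ℕ → ℝ) (ω : Ω) :
    stepIntegral n τ c (noiseCoeff A β l m) ω =
      α * ((∑ k ∈ Finset.range n,
        c k * (modeNoise β p (τ (k + 1)) ω - modeNoise β p (τ k) ω) : ℝ) : ℂ) +
      γ * ((∑ k ∈ Finset.range n,
        c k * (modeNoise β q (τ (k + 1)) ω - modeNoise β q (τ k) ω) : ℝ) : ℂ) := by
  simp only [stepIntegral, noiseCoeff, hd, modeNoise, Complex.ofReal_sum, Finset.mul_sum]
  rw [← Finset.sum_add_distrib]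
  refine Finset.sum_congr rfl fun k _ ↦ ?_
  push_cast
  ring

variable {Ω : Type*} [MeasurableSpace Ω] {P : Measure Ω}

theorem eLpNorm_two_terms_le (α γ : ℂ) {f g : Ω → ℝ} (hf : AEStronglyMeasurable f P)
    (hg : AEStronglyMeasurable g P) :
    eLpNorm (fun ω ↦ α * (f ω : ℂ) + γ * (g ω : ℂ)) 2 P ≤
      ‖α‖ₑ * eLpNorm f 2 P + ‖γ‖ₑ * eLpNorm g 2 P := by
  have hf' : AEStronglyMeasurable (fun ω ↦ (f ω : ℂ)) P :=
    Complex.continuous_ofReal.comp_aestronglyMeasurable hf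
  have hg' : AEStronglyMeasurable (fun ω ↦ (g ω : ℂ)) P :=
    Complex.continuous_ofReal.comp_aestronglyMeasurable hg
  have e : ∀ (a : ℂ) (u : Ω → ℝ), eLpNorm (fun ω ↦ a * (u ω : ℂ)) 2 P = ‖a‖ₑ * eLpNorm u 2 P :=
    fun a u ↦ by
      have := eLpNorm_const_smul a (fun ω ↦ (u ω : ℂ)) 2 P
      refine this.trans (congrArg _ (eLpNorm_congr_norm_ae (ae_of_all _ fun ω ↦ ?_)))
      simp
  rw [← e α f, ← e γ g]
  exact eLpNorm_add_le (hf'.const_mul α) (hg'.const_mul γ) (by norm_num)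

variable {T : ℝ≥0} {A : ℕ → ℝ} {β : Fin 2 → ℕ → ℕ → ℝ≥0 → Ω → ℝ} {t : ℝ≥0}

namespace IsGaussianWeights

variable {C : ℕ → Matrix (Fin 2) (Fin 2) ℝ} {b : Ω → Fin 2 → Fin 2 → ℕ → ℕ → ℝ}

theorem memLp_fieldCoeff (h : IsGaussianWeights C b P) {l : ℕ} {m : ℤ} (hA : 0 ≤ A l)
    (hm : |m| ≤ (l : ℤ)) (j : Fin 2) : MemLp (fun ω ↦ fieldCoeff A (b ω j) l m) 2 P := by
  obtain ⟨α, γ, p, q, -, -, -, -, hd⟩ := exists_fieldCoeff_eq hA hm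
  simp only [hd]
  exact ((h.memLp (p, j)).ofReal.const_mul α).add ((h.memLp (q, j)).ofReal.const_mul γ)

theorem integral_fieldCoeff [IsProbabilityMeasure P] (h : IsGaussianWeights C b P) {l : ℕ} {m : ℤ}
    (hA : 0 ≤ A l) (hm : |m| ≤ (l : ℤ)) (j : Fin 2) :
    ∫ ω, fieldCoeff A (b ω j) l m ∂P = 0 := by
  obtain ⟨α, γ, p, q, -, -, -, -, hd⟩ := exists_fieldCoeff_eq hA hm
  simp only [hd]
  have hp := ((h.memLp (p, j)).integrable (by norm_num)).ofReal (𝕜 := ℂ)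
  have hq := ((h.memLp (q, j)).integrable (by norm_num)).ofReal (𝕜 := ℂ)
  have h1 : ∫ ω, (b ω j p.1.1 p.1.2.1 p.1.2.2 : ℂ) ∂P = 0 := by
    rw [integral_complex_ofReal]
    exact_mod_cast h.mean (p, j)
  have h2 : ∫ ω, (b ω j q.1.1 q.1.2.1 q.1.2.2 : ℂ) ∂P = 0 := by
    rw [integral_complex_ofReal]
    exact_mod_cast h.mean (q, j)
  refine (integral_add (hp.const_mul α) (hq.const_mul γ)).trans ?_
  rw [integral_const_mul, integral_const_mul]
  erw [h1, h2]
  simp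

/-- The cross terms vanish because the two modes are uncorrelated or `γ = 0`; what remains is `|α|²
+ |γ|² = A_l` times `C l`. -/
theorem integral_fieldCoeff_mul_conj (h : IsGaussianWeights C b P) {l : ℕ} {m : ℤ}
    (hA : 0 ≤ A l) (hm : |m| ≤ (l : ℤ)) (j k : Fin 2) :
    ∫ ω, fieldCoeff A (b ω j) l m * (starRingEnd ℂ) (fieldCoeff A (b ω k) l m) ∂P =
      ((A l * C l j k : ℝ) : ℂ) := by
  obtain ⟨α, γ, p, q, hp, hq, hpq, hα, hd⟩ := exists_fieldCoeff_eq hA hm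
  simp only [hd]
  have hint : ∀ r s : ModeIndex, Integrable
      (fun ω ↦ ((weightVar b (r, j) ω * weightVar b (s, k) ω : ℝ) : ℂ)) P := fun r s ↦
    ((h.memLp (r, j)).integrable_mul (h.memLp (s, k))).ofReal
  have hcov : ∀ r s : ModeIndex,
      ∫ ω, ((weightVar b (r, j) ω * weightVar b (s, k) ω : ℝ) : ℂ) ∂P =
        if r = s then (C r.1.2.1 j k : ℂ) else 0 := fun r s ↦ by
    rw [integral_complex_ofReal, h.cov]
    split_ifs <;> simp
  have e : ∀ ω, (α * (b ω j p.1.1 p.1.2.1 p.1.2.2 : ℂ) + γ * (b ω j q.1.1 q.1.2.1 q.1.2.2 : ℂ)) *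
      (starRingEnd ℂ) (α * (b ω k p.1.1 p.1.2.1 p.1.2.2 : ℂ) +
        γ * (b ω k q.1.1 q.1.2.1 q.1.2.2 : ℂ)) =
      α * (starRingEnd ℂ) α * ((weightVar b (p, j) ω * weightVar b (p, k) ω : ℝ) : ℂ) +
      α * (starRingEnd ℂ) γ * ((weightVar b (p, j) ω * weightVar b (q, k) ω : ℝ) : ℂ) +
      (γ * (starRingEnd ℂ) α * ((weightVar b (q, j) ω * weightVar b (p, k) ω : ℝ) : ℂ) +
      γ * (starRingEnd ℂ) γ * ((weightVar b (q, j) ω * weightVar b (q, k) ω : ℝ) : ℂ)) := fun ω ↦ by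
    simp only [map_add, map_mul, Complex.conj_ofReal, weightVar]
    push_cast
    ring
  simp_rw [e]
  rw [integral_add (((hint p p).const_mul _).fun_add ((hint p q).const_mul _))
      (((hint q p).const_mul _).fun_add ((hint q q).const_mul _)),
    integral_add ((hint p p).const_mul _) ((hint p q).const_mul _),
    integral_add ((hint q p).const_mul _) ((hint q q).const_mul _),
    integral_const_mul, integral_const_mul, integral_const_mul, integral_const_mul,
    hcov, hcov, hcov, hcov, if_pos rfl, if_pos rfl, hp, hq]
  push_cast
  rw [← hα]
  rcases hpq with h0 | hne
  · simp [h0]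
  · rw [if_neg hne, if_neg hne.symm]
    ring

end IsGaussianWeights

namespace IsIsotropicWiener

variable [IsProbabilityMeasure P] (hβ : IsIsotropicWiener T A β P) (ht : t ≤ T)

omit [IsProbabilityMeasure P] in
include hβ ht in
theorem aestronglyMeasurable_sum_modeNoise (p : ModeIndex) {n : ℕ} {τ : ℕ → ℝ≥0} (hτ : Monotone τ)
    (hτt : τ n ≤ t) (c : ℕ → ℝ) : AEStronglyMeasurable (fun ω ↦ ∑ k ∈ Finset.range n,
      c k * (modeNoise β p (τ (k + 1)) ω - modeNoise β p (τ k) ω)) P :=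
  (Lp.aestronglyMeasurable _).congr (hβ.coeFn_linearCombination_noiseLp ht p hτ hτt c)

/-- The isometry applied to each of the two modes, with `K = |α| + |γ|`. Since `K` does not depend
on the partition, both existence and uniqueness of the Wiener integral follow. -/
theorem eLpNorm_fieldCoeff_sub_stepIntegral_le {l : ℕ} {m : ℤ} (hm : |m| ≤ (l : ℤ)) (j : Fin 2) :
    ∃ K : ℝ≥0, ∀ (n : ℕ) (τ : ℕ → ℝ≥0) (c : ℕ → ℝ), Monotone τ → τ n ≤ t →
      AEStronglyMeasurable (stepIntegral n τ c (noiseCoeff A β l m)) P ∧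
      eLpNorm (fun ω ↦ fieldCoeff A (hβ.convWeight ht ω j) l m -
        stepIntegral n τ c (noiseCoeff A β l m) ω) 2 P ≤
      K * eLpNorm (fun s ↦ propagator l j (t - s) - stepFun n τ c s) 2
        (volume.restrict (Set.Icc 0 (t : ℝ))) := by
  obtain ⟨α, γ, p, q, hp, hq, -, -, hd⟩ := exists_fieldCoeff_eq (hβ.spectrum_nonneg l) hm
  refine ⟨‖α‖₊ + ‖γ‖₊, fun n τ c hτ hτt ↦ ⟨?_, ?_⟩⟩
  · have := ((Complex.continuous_ofReal.comp_aestronglyMeasurable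
      (hβ.aestronglyMeasurable_sum_modeNoise ht p hτ hτt c)).const_mul α).add
      ((Complex.continuous_ofReal.comp_aestronglyMeasurable
      (hβ.aestronglyMeasurable_sum_modeNoise ht q hτ hτt c)).const_mul γ)
    exact this.congr (ae_of_all _ fun ω ↦ (stepIntegral_noiseCoeff hd n τ c ω).symm)
  · have e : ∀ ω, fieldCoeff A (hβ.convWeight ht ω j) l m -
        stepIntegral n τ c (noiseCoeff A β l m) ω =
        α * ((weightVar (hβ.convWeight ht) (p, j) ω - ∑ k ∈ Finset.range n,
          c k * (modeNoise β p (τ (k + 1)) ω - modeNoise β p (τ k) ω) : ℝ) : ℂ) +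
        γ * ((weightVar (hβ.convWeight ht) (q, j) ω - ∑ k ∈ Finset.range n,
          c k * (modeNoise β q (τ (k + 1)) ω - modeNoise β q (τ k) ω) : ℝ) : ℂ) := fun ω ↦ by
      rw [stepIntegral_noiseCoeff hd, hd]
      simp only [weightVar]
      push_cast
      ring
    simp_rw [e]
    refine (eLpNorm_two_terms_le α γ ?_ ?_).trans_eq ?_
    · rw [weightVar_convWeight]
      exact (Lp.aestronglyMeasurable _).sub (hβ.aestronglyMeasurable_sum_modeNoise ht p hτ hτt c)
    · rw [weightVar_convWeight]
      exact (Lp.aestronglyMeasurable _).sub (hβ.aestronglyMeasurable_sum_modeNoise ht q hτ hτt c)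
    · rw [weightVar_convWeight, weightVar_convWeight, hβ.eLpNorm_wienerLp_sub ht p _ hτ hτt,
        hβ.eLpNorm_wienerLp_sub ht q _ hτ hτt, hp, hq, ← add_mul]
      rfl

theorem isWienerIntegral_fieldCoeff {l : ℕ} {m : ℤ} (hm : |m| ≤ (l : ℤ)) (j : Fin 2) :
    IsWienerIntegral (noiseCoeff A β l m) (fun s ↦ propagator l j (t - s)) t P
      fun ω ↦ fieldCoeff A (hβ.convWeight ht ω j) l m := by
  obtain ⟨K, hK⟩ := hβ.eLpNorm_fieldCoeff_sub_stepIntegral_le ht hm j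
  refine ⟨(hβ.isGaussianWeights_convWeight ht).memLp_fieldCoeff (hβ.spectrum_nonneg l) hm j,
    fun ε hε ↦ ?_⟩
  have h := tendsto_eLpNorm_sub_gridStep (t := t) (continuous_propagator_sub l j t).continuousOn
  have h' := ENNReal.Tendsto.const_mul (a := (K : ℝ≥0∞)) h (Or.inr ENNReal.coe_ne_top)
  rw [mul_zero] at h'
  obtain ⟨n, h1, h2⟩ := ((h.eventually_lt_const hε).and (h'.eventually_lt_const hε)).exists
  refine ⟨n + 1, gridPoint t n, _, gridPoint_mono t n, (gridPoint_last t n).le, h1, ?_⟩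
  exact ((hK _ _ _ (gridPoint_mono t n) (gridPoint_last t n).le).2).trans_lt h2

/-- An elementary integral within `ε` of `Y` whose integrand is within `ε` of the kernel is within
`K ε` of the coefficient. The chosen version in `wienerIntegral` is therefore immaterial. -/
theorem ae_eq_of_isWienerIntegral {l : ℕ} {m : ℤ} (hm : |m| ≤ (l : ℤ)) (j : Fin 2) {Y : Ω → ℂ}
    (hY : IsWienerIntegral (noiseCoeff A β l m) (fun s ↦ propagator l j (t - s)) t P Y) :
    Y =ᵐ[P] fun ω ↦ fieldCoeff A (hβ.convWeight ht ω j) l m := by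
  obtain ⟨K, hK⟩ := hβ.eLpNorm_fieldCoeff_sub_stepIntegral_le ht hm j
  have hF := (hβ.isGaussianWeights_convWeight ht).memLp_fieldCoeff (hβ.spectrum_nonneg l) hm j
  have hle : ∀ ε : ℝ≥0∞, 0 < ε →
      eLpNorm (fun ω ↦ Y ω - fieldCoeff A (hβ.convWeight ht ω j) l m) 2 P ≤ (1 + K) * ε := by
    intro ε hε
    obtain ⟨n, τ, c, hτ, hτt, h1, h2⟩ := hY.2 ε hε
    obtain ⟨h3, h4⟩ := hK n τ c hτ hτt
    have e : (fun ω ↦ Y ω - fieldCoeff A (hβ.convWeight ht ω j) l m) =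
        (fun ω ↦ Y ω - stepIntegral n τ c (noiseCoeff A β l m) ω) -
        fun ω ↦ fieldCoeff A (hβ.convWeight ht ω j) l m -
          stepIntegral n τ c (noiseCoeff A β l m) ω := by
      ext ω
      simp
    rw [e, add_mul, one_mul]
    refine (eLpNorm_sub_le (hY.1.1.sub h3) (hF.1.sub h3) (by norm_num)).trans ?_
    exact add_le_add h2.le (h4.trans (by gcongr))
  have h0 : eLpNorm (fun ω ↦ Y ω - fieldCoeff A (hβ.convWeight ht ω j) l m) 2 P = 0 := by
    have h := ENNReal.Tendsto.const_mul (a := 1 + (K : ℝ≥0∞)) ENNReal.tendsto_inv_nat_nhds_zero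
      (Or.inr (by simp))
    rw [mul_zero] at h
    exact le_antisymm (ge_of_tendsto' h fun n ↦ hle _ (by simp)) zero_le
  filter_upwards [(eLpNorm_eq_zero_iff (hY.1.1.sub hF.1) (by norm_num)).1 h0] with ω h
  exact sub_eq_zero.1 h

end IsIsotropicWiener

end Coefficients

/-! ### Identification of the convolution coefficients -/

section ConvolutionCoefficients

variable {Ω : Type*} [MeasurableSpace Ω] {P : Measure Ω} [IsProbabilityMeasure P]
variable {T : ℝ≥0} {A : ℕ → ℝ} {β : Fin 2 → ℕ → ℕ → ℝ≥0 → Ω → ℝ} {t : ℝ≥0}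

namespace IsIsotropicWiener

variable (hβ : IsIsotropicWiener T A β P) (ht : t ≤ T)

include hβ in
theorem modeNoise_zero_ae_eq (p : ModeIndex) : modeNoise β p 0 =ᵐ[P] 0 := by
  have h := hβ.integral_mul p p (s := 0) (r := 0) zero_le zero_le
  have hL := hβ.memLp p (s := 0) zero_le
  rw [if_pos rfl, min_self, NNReal.coe_zero, mul_zero,
    integral_eq_zero_iff_of_nonneg (fun ω ↦ mul_self_nonneg _) (hL.integrable_mul hL)] at h
  filter_upwards [h] with ω hω
  exact mul_self_eq_zero.1 hω

theorem wienerLp_ae_eq_of_eq_one (p : ModeIndex) {f : ℝ → ℝ} (hf : Continuous f)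
    (h1 : ∀ s, f s = 1) : hβ.wienerLp ht p hf =ᵐ[P] modeNoise β p t := by
  -- A single cell `(0, t]` represents the constant 1 exactly, up to the null point 0.
  have hτ : Monotone fun k : ℕ ↦ if k = 0 then 0 else t := fun i k hik ↦ by
    dsimp only
    split_ifs <;> first | omega | simp
  have h := hβ.eLpNorm_wienerLp_sub ht p hf (n := 1) hτ (by simp) fun _ ↦ 1
  have h0 : eLpNorm (fun s ↦ f s - stepFun 1 (fun k : ℕ ↦ if k = 0 then 0 else t) (fun _ ↦ 1) s) 2
      (volume.restrict (Set.Icc 0 (t : ℝ))) = 0 := by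
    rw [← eLpNorm_zero (ε := ℝ) (p := 2) (μ := volume.restrict (Set.Icc 0 (t : ℝ))),
      ← restrict_Ioc_eq_restrict_Icc]
    refine eLpNorm_congr_ae ((ae_restrict_iff' measurableSet_Ioc).2 (ae_of_all _ fun s hs ↦ ?_))
    simp [stepFun, h1, hs.1, hs.2]
  rw [h0] at h
  have hm : AEStronglyMeasurable (modeNoise β p t) P := (hβ.memLp p ht).1
  have hm0 : AEStronglyMeasurable (modeNoise β p 0) P := (hβ.memLp p zero_le).1
  simp only [Finset.range_one, Finset.sum_singleton, one_mul, zero_add, one_ne_zero, if_false,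
    if_true] at h
  filter_upwards [(eLpNorm_eq_zero_iff ((Lp.aestronglyMeasurable _).sub (hm.sub hm0))
    (by norm_num)).1 h, hβ.modeNoise_zero_ae_eq p] with ω h2 h3
  simp only [Pi.sub_apply, h3, Pi.zero_apply, sub_zero] at h2
  exact sub_eq_zero.1 h2

/-- Integration by parts on the grid: the elementary integrals of `t - s` with right endpoints are
left Riemann sums of the path, as the boundary terms vanish with `t - t` and with the initial value
of the Brownian motion. -/
theorem wienerLp_ae_eq_integral (p : ModeIndex) {f : ℝ → ℝ} (hf : Continuous f)
    (hft : ∀ s, f s = t - s) :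
    hβ.wienerLp ht p hf =ᵐ[P] fun ω ↦ ∫ s in (0 : ℝ)..t, modeNoise β p s.toNNReal ω := by
  have hlim := tendsto_eLpNorm_sub_gridStep (t := t) hf.continuousOn
  let S (n : ℕ) (ω : Ω) : ℝ := ∑ k ∈ Finset.range (n + 1), f (gridPoint t n (k + 1)) *
    (modeNoise β p (gridPoint t n (k + 1)) ω - modeNoise β p (gridPoint t n k) ω)
  have hS : ∀ n, AEStronglyMeasurable (S n) P := fun n ↦
    hβ.aestronglyMeasurable_sum_modeNoise ht p (gridPoint_mono t n) (gridPoint_last t n).le _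
  have hS2 : Tendsto (fun n ↦ eLpNorm (S n - ⇑(hβ.wienerLp ht p hf)) 2 P) atTop (𝓝 0) := by
    refine hlim.congr fun n ↦ ?_
    rw [eLpNorm_sub_comm]
    exact (hβ.eLpNorm_wienerLp_sub ht p hf (gridPoint_mono t n) (gridPoint_last t n).le _).symm
  -- The `L²` limit has to be matched with a pathwise limit, so an almost surely convergent
  -- subsequence is needed.
  obtain ⟨ns, hns, hae⟩ := (tendstoInMeasure_of_tendsto_eLpNorm (by norm_num) hS
    (Lp.aestronglyMeasurable _) hS2).exists_seq_tendsto_ae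
  filter_upwards [hae, hβ.modeNoise_zero_ae_eq p, (hβ.brownian p).cont] with ω h1 h2 h3
  have hc : ContinuousOn (fun s : ℝ ↦ modeNoise β p s.toNNReal ω) (Set.Icc 0 (t : ℝ)) :=
    ContinuousOn.comp (g := fun s ↦ modeNoise β p s ω) h3 continuous_real_toNNReal.continuousOn
      fun s hs ↦ (Real.toNNReal_le_iff_le_coe.2 hs.2).trans ht
  refine tendsto_nhds_unique h1 (((tendsto_sum_gridPoint hc).comp hns.tendsto_atTop).congr
    fun i ↦ ?_)
  simp only [Function.comp_apply, S, hft, Real.toNNReal_coe]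
  rw [sum_range_mul_sub (ns i + 1) (fun k ↦ modeNoise β p (gridPoint t (ns i) k) ω)
    fun k ↦ (t : ℝ) - gridPoint t (ns i) k]
  simp [h2]

include hβ ht in
theorem isWienerIntegral_convCoeff {l : ℕ} (hl : l ≠ 0) {m : ℤ} (hm : |m| ≤ (l : ℤ)) (j : Fin 2) :
    IsWienerIntegral (noiseCoeff A β l m) (fun s ↦ waveKernel l j ((t : ℝ) - s)) t P
      (convCoeff A β P t l m j) := by
  have h := hβ.isWienerIntegral_fieldCoeff ht hm j
  simp only [propagator, if_neg hl] at h
  rw [convCoeff, if_neg hl, wienerIntegral, dif_pos ⟨_, h⟩]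
  exact Exists.choose_spec (p := IsWienerIntegral _ _ _ _) ⟨_, h⟩

theorem convCoeff_ae_eq {l : ℕ} {m : ℤ} (hm : |m| ≤ (l : ℤ)) (j : Fin 2) :
    convCoeff A β P t l m j =ᵐ[P] fun ω ↦ fieldCoeff A (hβ.convWeight ht ω j) l m := by
  by_cases hl : l = 0
  · subst hl
    obtain rfl : m = 0 := by simpa using hm
    let p : ModeIndex := ⟨(0, 0, 0), by simp⟩
    have hw : ∀ ω, hβ.convWeight ht ω j 0 0 0 =
        hβ.wienerLp ht p (continuous_propagator_sub 0 j t) ω :=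
      fun ω ↦ congrFun (hβ.weightVar_convWeight ht p j) ω
    simp only [convCoeff, fieldCoeff, noiseCoeff, if_true, hw]
    fin_cases j
    · filter_upwards [hβ.wienerLp_ae_eq_integral ht p (continuous_propagator_sub 0 0 t)
        fun s ↦ by simp [propagator]] with ω hω
      simp only [Fin.zero_eta, Matrix.cons_val_zero]
      rw [hω, intervalIntegral.integral_const_mul, intervalIntegral.integral_ofReal]
      rfl
    · filter_upwards [hβ.wienerLp_ae_eq_of_eq_one ht p (continuous_propagator_sub 0 1 t)
        fun s ↦ by simp [propagator]] with ω hω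
      simp only [Fin.mk_one, Matrix.cons_val_one, Matrix.cons_val_fin_one]
      rw [hω]
      rfl
  · have h := hβ.isWienerIntegral_convCoeff ht hl hm j
    refine hβ.ae_eq_of_isWienerIntegral ht hm j ?_
    simpa only [propagator, if_neg hl] using h

/-- There are countably many coefficients, so one null set carries all discrepancies between
versions. -/
theorem isStochConv_iff {Z : Fin 2 → S2 → Ω → ℝ} :
    IsStochConv A β P t Z ↔
      IsFieldSum (fun N j y ω ↦ realExpansion A (hβ.convWeight ht ω j) N y) Z P := by
  refine isFieldSum_ofReal_iff ?_
  have h : ∀ᵐ ω ∂P, ∀ (l : ℕ) (m : ℤ) (j : Fin 2), |m| ≤ (l : ℤ) →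
      convCoeff A β P t l m j ω = fieldCoeff A (hβ.convWeight ht ω j) l m := by
    simp only [ae_all_iff]
    exact fun l m j hm ↦ hβ.convCoeff_ae_eq ht hm j
  filter_upwards [h] with ω hω N j y
  rw [← complexExpansion_fieldCoeff]
  refine Finset.sum_congr rfl fun l _ ↦ Finset.sum_congr rfl fun m hm ↦ ?_
  exact congrArg (· * sphHarm l m y) (hω l m j (abs_le.2 (Finset.mem_Icc.1 hm)))

end IsIsotropicWiener

end ConvolutionCoefficients

/-! ### Weights built from independent normal variables -/

section CholeskyWeights

variable {Ω : Type*} [MeasurableSpace Ω] {P : Measure Ω}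

theorem isGaussianProcess_of_iIndepFun_real {ι : Type*} {X : ι → Ω → ℝ}
    (hX : ∀ i, HasGaussianLaw (X i) P) (hind : iIndepFun X P) : IsGaussianProcess X P :=
  ⟨fun I ↦ (hind.precomp (g := ((↑) : I → ι)) Subtype.val_injective).hasGaussianLaw fun i ↦ hX i⟩

theorem isGaussianWeights_cholWeight [IsProbabilityMeasure P] {D C : ℕ → Matrix (Fin 2) (Fin 2) ℝ}
    {X : Fin 2 → ℕ → ℕ → Fin 2 → Ω → ℝ}
    (hX_law : ∀ (p : ModeIndex) (k : Fin 2),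
      HasLaw (X p.1.1 p.1.2.1 p.1.2.2 k) (gaussianReal 0 1) P)
    (hX_indep : iIndepFun
      (fun q : ModeIndex × Fin 2 ↦ X q.1.1.1 q.1.1.2.1 q.1.1.2.2 q.2) P)
    (hD : ∀ l, D l * (D l).transpose = C l) :
    IsGaussianWeights C (fun ω ↦ cholWeight D X ω) P := by
  set Y : ModeIndex × Fin 2 → Ω → ℝ := fun q ↦ X q.1.1.1 q.1.1.2.1 q.1.1.2.2 q.2 with hY
  have hlaw : ∀ q, HasLaw (Y q) (gaussianReal 0 1) P := fun q ↦ hX_law q.1 q.2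
  have hL : ∀ q, HasGaussianLaw (Y q) P := fun q ↦ (hlaw q).hasGaussianLaw
  have hL2 : ∀ q, MemLp (Y q) 2 P := fun q ↦ (hL q).memLp_two
  have hw : ∀ p j, weightVar (fun ω ↦ cholWeight D X ω) (p, j) =
      fun ω ↦ ∑ k, D p.1.2.1 j k * Y (p, k) ω := fun p j ↦ rfl
  have hmean : ∀ q, ∫ ω, Y q ω ∂P = 0 := fun q ↦ by
    rw [(hlaw q).integral_eq, integral_id_gaussianReal]
  have hint : ∀ q r, Integrable (fun ω ↦ Y q ω * Y r ω) P := fun q r ↦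
    (hL2 q).integrable_mul (hL2 r)
  have hcov : ∀ q r, ∫ ω, Y q ω * Y r ω ∂P = if q = r then 1 else 0 := fun q r ↦ by
    split_ifs with h
    · subst h
      have hv := (hlaw q).variance_eq
      rw [variance_id_gaussianReal, variance_of_integral_eq_zero (hL q).aemeasurable (hmean q)] at hv
      simpa [sq] using hv
    · rw [(hX_indep.indepFun h).integral_fun_mul_eq_mul_integral (hL2 q).1 (hL2 r).1]
      exact mul_eq_zero_of_left (hmean q) _
  refine ⟨?_, ?_, ?_⟩
  · have hproc := isGaussianProcess_of_iIndepFun_real hL hX_indep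
    refine hproc.of_isGaussianProcess ?_
    classical
    rintro ⟨p, j⟩
    -- Each weight is a linear functional of the two normal variables of its mode, so joint
    -- Gaussianity is inherited.
    let L : (({(p, 0), (p, 1)} : Finset (ModeIndex × Fin 2)) → ℝ) →L[ℝ] ℝ :=
      D p.1.2.1 j 0 • ContinuousLinearMap.proj ⟨(p, 0), by simp⟩ +
      D p.1.2.1 j 1 • ContinuousLinearMap.proj ⟨(p, 1), by simp⟩
    refine ⟨_, L, fun ω ↦ ?_⟩
    simp [hw, L, Fin.sum_univ_two]
  · rintro ⟨p, j⟩
    rw [hw, integral_finsetSum _ fun k _ ↦ ((hL2 (p, k)).integrable (by norm_num)).const_mul _]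
    simp [integral_const_mul, hmean]
  · intro p j q k
    rw [hw, hw]
    simp only [Finset.sum_mul_sum]
    have e : ∀ a b ω, D p.1.2.1 j a * Y (p, a) ω * (D q.1.2.1 k b * Y (q, b) ω) =
        D p.1.2.1 j a * D q.1.2.1 k b * (Y (p, a) ω * Y (q, b) ω) := fun a b ω ↦ by ring
    simp_rw [e]
    rw [integral_finsetSum _ fun a _ ↦ integrable_finsetSum _ fun b _ ↦ (hint _ _).const_mul _]
    simp_rw [integral_finsetSum _ fun b _ ↦ (hint _ _).const_mul _, integral_const_mul, hcov]
    split_ifs with h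
    · subst h
      rw [← hD, Matrix.mul_apply]
      refine Finset.sum_congr rfl fun a _ ↦ ?_
      simp [Prod.mk.injEq, Matrix.transpose_apply]
    · simp [Prod.mk.injEq, h]

end CholeskyWeights

/-! ### The proposition -/

theorem proposition3p1 {Ω Ω' : Type*} [MeasurableSpace Ω] [MeasurableSpace Ω']
    (P : Measure Ω) [IsProbabilityMeasure P] (P' : Measure Ω') [IsProbabilityMeasure P']
    (T : ℝ≥0) (A : ℕ → ℝ) (β : Fin 2 → ℕ → ℕ → ℝ≥0 → Ω → ℝ)
    (hβ : IsIsotropicWiener T A β P) (t : ℝ≥0) (ht : t ≤ T)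
    (X : Fin 2 → ℕ → ℕ → Fin 2 → Ω' → ℝ)
    (hX_law : ∀ (p : ModeIndex) (k : Fin 2),
      HasLaw (X p.1.1 p.1.2.1 p.1.2.2 k) (gaussianReal 0 1) P')
    (hX_indep : iIndepFun
      (fun q : ModeIndex × Fin 2 ↦ X q.1.1.1 q.1.1.2.1 q.1.1.2.2 q.2) P') :
    -- the coefficient pairs are well defined, centered, with covariance matrix `A_l C_l(t)`
    (∀ (l : ℕ) (m : ℤ), |m| ≤ (l : ℤ) →
      (l ≠ 0 → ∀ j, IsWienerIntegral (noiseCoeff A β l m)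
        (fun s ↦ waveKernel l j ((t : ℝ) - s)) t P (convCoeff A β P t l m j)) ∧
      (∀ j, MemLp (convCoeff A β P t l m j) 2 P ∧ ∫ ω, convCoeff A β P t l m j ω ∂P = 0) ∧
      ∀ i j, ∫ ω, convCoeff A β P t l m i ω * (starRingEnd ℂ) (convCoeff A β P t l m j ω) ∂P =
        ((A l * covMatrix l t i j : ℝ) : ℂ)) ∧
    -- the matrices `C_l(t)` have a unique Cholesky factor
    (∀ l : ℕ, ∃! D, IsCholeskyFactor D (covMatrix l t)) ∧
    -- the stochastic convolution exists and is a centered Gaussian field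
    (∃ Z, IsStochConv A β P t Z) ∧
    (∀ Z, IsStochConv A β P t Z →
      IsGaussianProcess (fun q : Fin 2 × S2 ↦ Z q.1 q.2) P ∧
      ∀ j y, Integrable (Z j y) P ∧ ∫ ω, Z j y ω ∂P = 0) ∧
    -- equality in distribution, for every `D_l` with `D_l D_lᵀ = C_l(t)`, such as the Cholesky factor
    ∀ D : ℕ → Matrix (Fin 2) (Fin 2) ℝ, (∀ l, D l * (D l).transpose = covMatrix l t) →
      IdentDistrib
        (fun ω (q : {p : ℕ × ℤ // |p.2| ≤ (p.1 : ℤ)} × Fin 2) ↦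
          convCoeff A β P t q.1.1.1 q.1.1.2 q.2 ω)
        (fun ω (q : {p : ℕ × ℤ // |p.2| ≤ (p.1 : ℤ)} × Fin 2) ↦
          fieldCoeff A (cholWeight D X ω q.2) q.1.1.1 q.1.1.2) P P' ∧
      (∃ Z', IsFieldSum (fun N j y ω ↦ realExpansion A (cholWeight D X ω j) N y) Z' P') ∧
      (∀ Z Z', IsStochConv A β P t Z →
        IsFieldSum (fun N j y ω ↦ realExpansion A (cholWeight D X ω j) N y) Z' P' →
        IdentDistrib (fun ω (q : Fin 2 × S2) ↦ Z q.1 q.2 ω)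
          (fun ω (q : Fin 2 × S2) ↦ Z' q.1 q.2 ω) P P') ∧
      ∀ (N : ℕ) (j : Fin 2) (ω : Ω'), ∀ θ ∈ Set.Icc 0 Real.pi, ∀ φ ∈ Set.Ico 0 (2 * Real.pi),
        realExpansion A (cholWeight D X ω j) N (sphPoint θ φ) =
          angularExpansion A (cholWeight D X ω j) N θ φ := by
  have hW := hβ.isGaussianWeights_convWeight ht
  have hC := fun l j ↦ covMatrix_diag_le l j t.coe_nonneg
  refine ⟨fun l m hm ↦ ⟨fun hl j ↦ hβ.isWienerIntegral_convCoeff ht hl hm j, fun j ↦ ⟨?_, ?_⟩,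
    fun i j ↦ ?_⟩, fun l ↦ existsUnique_isCholeskyFactor_covMatrix l t.coe_nonneg, ?_, ?_, ?_⟩
  · exact (hW.memLp_fieldCoeff (hβ.spectrum_nonneg l) hm j).ae_eq (hβ.convCoeff_ae_eq ht hm j).symm
  · rw [integral_congr_ae (hβ.convCoeff_ae_eq ht hm j)]
    exact hW.integral_fieldCoeff (hβ.spectrum_nonneg l) hm j
  · rw [← hW.integral_fieldCoeff_mul_conj (hβ.spectrum_nonneg l) hm i j]
    refine integral_congr_ae ?_
    filter_upwards [hβ.convCoeff_ae_eq ht hm i, hβ.convCoeff_ae_eq ht hm j] with ω h1 h2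
    rw [h1, h2]
  · obtain ⟨Z, hZ⟩ := hW.exists_isFieldSum hβ.spectrum_nonneg hβ.trace_class hC
    exact ⟨Z, (hβ.isStochConv_iff ht).2 hZ⟩
  · intro Z hZ
    rw [hβ.isStochConv_iff ht] at hZ
    exact ⟨hW.isGaussianProcess_of_isFieldSum hZ, fun j y ↦
      ⟨(hW.memLp_of_isFieldSum hZ (j, y)).integrable (by norm_num),
        hW.integral_eq_zero_of_isFieldSum hZ j y⟩⟩
  · intro D hD
    have hX := isGaussianWeights_cholWeight hX_law hX_indep hD
    refine ⟨?_, hX.exists_isFieldSum hβ.spectrum_nonneg hβ.trace_class hC, fun Z Z' hZ hZ' ↦ ?_,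
      fun N j ω θ hθ φ _ ↦ realExpansion_sphPoint A _ N hθ φ⟩
    · have h := hW.identDistrib_fieldCoeff hX A
      -- The index set is countable, so the whole family of coefficients agrees almost surely with
      -- the one built from the convolution weights.
      refine (IdentDistrib.of_ae_eq h.aemeasurable_fst ?_).symm.trans h
      filter_upwards [ae_all_iff.2 fun q : {p : ℕ × ℤ // |p.2| ≤ (p.1 : ℤ)} × Fin 2 ↦
        hβ.convCoeff_ae_eq ht q.1.2 q.2] with ω hω
      exact funext fun q ↦ (hω q).symm
    · exact hW.identDistrib_field hX ((hβ.isStochConv_iff ht).1 hZ) hZ'
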